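/- All graphs are finite and simple. A planar straight-line drawing $\Gamma$ of a graph $G$ maps the vertices of $G$ to distinct points of the Euclidean plane and each edge to the segment joining its end-vertices, so that no edge passes through a vertex other than its end-vertices and two distinct edges intersect at most in a common end-vertex. Let $|e|_\Gamma$ be the length of the segment that represents the edge $e$. The global edge-length ratio of $\Gamma$ is $\rho_g(\Gamma)=\max_{e,e'\in E(G)} |e|_\Gamma/|e'|_\Gamma$, and the global edge-length ratio of $G$ is $\rho_g(G)=\inf_\Gamma \rho_g(\Gamma)$, where $\Gamma$ ranges over all planar straight-line drawings of $G$ (with $\rho_g(G)=\infty$ if there is none). A Halin graph is a 3-connected graph $H$ with a planar embedding (given by the circular order of the edges around each vertex and the choice of the outer face) such that removing the edges incident to the outer face leaves a tree whose internal vertices have degree at least $3$ and whose leaves are incident to the outer face. A generalized Halin graph is a graph obtained from a Halin graph $H$ by subdividing edges of $H$ that do not belong to the boundary of the outer face: each such edge is subdivided any number of times (possibly zero), and the edges of the outer boundary are not subdivided. Theorem. If $G$ is a generalized Halin graph, then $\rho_g(G)\le 5$. -/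

import Mathlib

open scoped ENNReal

/-- The Euclidean plane. -/
abbrev Plane : Type := EuclideanSpace ℝ (Fin 2)

namespace SimpleGraph

/-! ### Planar straight-line drawings and the global edge-length ratio -/

/-- A planar straight-line drawing of `G`: distinct vertices are drawn at distinct points of the
plane, every edge is drawn as the segment between its end-vertices and passes through no other
vertex, and two distinct edges meet only in a common end-vertex. -/
structure PlanarStraightLineDrawing {V : Type*} (G : SimpleGraph V) where
  pos : V → Plane
  pos_injective : Function.Injective pos
  vertex_of_mem_segment : ∀ ⦃u v w : V⦄, G.Adj u v →
    pos w ∈ segment ℝ (pos u) (pos v) → w = u ∨ w = v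
  common_end_of_mem_segments : ∀ ⦃u v z w : V⦄, G.Adj u v → G.Adj z w → s(u, v) ≠ s(z, w) →
    ∀ x : Plane, x ∈ segment ℝ (pos u) (pos v) → x ∈ segment ℝ (pos z) (pos w) →
      ∃ y : V, (y = u ∨ y = v) ∧ (y = z ∨ y = w) ∧ x = pos y

/-- The global edge-length ratio of a drawing: the largest ratio between the lengths of two edges.
All edge lengths are positive and finite, so each quotient is the genuine one. -/
noncomputable def PlanarStraightLineDrawing.globalEdgeLengthRatio {V : Type*} {G : SimpleGraph V}
    (Γ : G.PlanarStraightLineDrawing) : ℝ≥0∞ :=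
  ⨆ (e : G.Dart) (e' : G.Dart),
    EDist.edist (Γ.pos e.fst) (Γ.pos e.snd) / EDist.edist (Γ.pos e'.fst) (Γ.pos e'.snd)

/-- The global edge-length ratio of a graph: the infimum over all its planar straight-line
drawings. It is `∞` for a graph without such a drawing. -/
noncomputable def globalEdgeLengthRatio {V : Type*} (G : SimpleGraph V) : ℝ≥0∞ :=
  ⨅ Γ : G.PlanarStraightLineDrawing, Γ.globalEdgeLengthRatio

/-! ### Embeddings, described by the circular orders of the edges around the vertices -/

/-- A circular order of the edges around each vertex. The dart `d` stands for the edge `d.edge`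
at its end-vertex `d.fst`, and `next d` is the edge that follows it around that vertex. -/
structure RotationSystem {V : Type*} (G : SimpleGraph V) where
  next : Equiv.Perm G.Dart
  fst_next : ∀ d : G.Dart, (next d).fst = d.fst
  sameCycle_of_fst_eq : ∀ d d' : G.Dart, d.fst = d'.fst → next.SameCycle d d'

namespace RotationSystem

variable {V : Type*} {G : SimpleGraph V} (R : G.RotationSystem)

/-- Face tracing: arrive at a vertex along the dart `d`, and leave it along the edge that follows
in the circular order. -/
def facePerm : Equiv.Perm G.Dart :=
  (Function.Involutive.toPerm Dart.symm Dart.symm_involutive).trans R.next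

/-- The faces are the orbits of face tracing. -/
abbrev Face : Type _ := Quotient (Equiv.Perm.SameCycle.setoid R.facePerm)

/-- The face whose boundary is traced through the dart `d`. -/
def faceOf (d : G.Dart) : R.Face := Quotient.mk (Equiv.Perm.SameCycle.setoid R.facePerm) d

/-- The circular orders are those of an embedding of the (connected, finite) graph in the plane,
that is, the surface that they determine has Euler characteristic 2. -/
def IsPlanar : Prop :=
  G.Connected ∧ Nat.card V + Nat.card R.Face = Nat.card G.edgeSet + 2

/-- The edges incident to the face `f`. -/
def faceEdges (f : R.Face) : Set (Sym2 V) := {e | ∃ d : G.Dart, R.faceOf d = f ∧ d.edge = e}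

/-- The vertices incident to the face `f`. -/
def faceVertices (f : R.Face) : Set V := {v | ∃ d : G.Dart, R.faceOf d = f ∧ d.fst = v}

end RotationSystem

/-! ### Halin graphs and generalized Halin graphs -/

/-- `G` has more than three vertices, and no removal of at most two vertices disconnects it. -/
def IsThreeConnected {V : Type*} (G : SimpleGraph V) : Prop :=
  3 < Nat.card V ∧ ∀ S : Finset V, S.card < 3 → (G.induce {v | v ∉ S}).Connected

/-- The finite graph `G`, embedded in the plane by the circular orders `R` and with outer face
`f`, is a Halin graph: it is 3-connected, and removing the edges incident to the outer face leaves
a tree whose internal vertices have degree at least 3 and whose leaves are incident to the outer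
face. -/
structure IsEmbeddedHalin {V : Type*} (G : SimpleGraph V) (R : G.RotationSystem) (f : R.Face) :
    Prop where
  finite : Finite V
  planar : R.IsPlanar
  threeConnected : G.IsThreeConnected
  isTree : (G.deleteEdges (R.faceEdges f)).IsTree
  three_le_degree : ∀ v : V, ((G.deleteEdges (R.faceEdges f)).neighborSet v).ncard ≠ 1 →
    3 ≤ ((G.deleteEdges (R.faceEdges f)).neighborSet v).ncard
  leaf_mem_outer : ∀ v : V, ((G.deleteEdges (R.faceEdges f)).neighborSet v).ncard = 1 →
    v ∈ R.faceVertices f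

/-- `G` is a subdivision of `H`: every edge of `H` is replaced by a path between (the images of)
its end-vertices, the interiors of these paths are pairwise disjoint and contain no vertex of `H`,
and `G` has no further vertices or edges. An edge that is not subdivided has a path of length 1. -/
structure Subdivision {V W : Type*} (H : SimpleGraph V) (G : SimpleGraph W) where
  vertex : V ↪ W
  path : ∀ d : H.Dart, G.Walk (vertex d.fst) (vertex d.snd)
  isPath : ∀ d : H.Dart, (path d).IsPath
  path_symm : ∀ d : H.Dart, path d.symm = (path d).reverse
  eq_end_of_vertex_mem : ∀ (d : H.Dart) (v : V), vertex v ∈ (path d).support →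
    v = d.fst ∨ v = d.snd
  interior_disjoint : ∀ (d d' : H.Dart) (w : W), w ∈ (path d).support → w ∈ (path d').support →
    d.edge = d'.edge ∨ w ∈ Set.range vertex
  vertex_covered : ∀ w : W, w ∈ Set.range vertex ∨ ∃ d : H.Dart, w ∈ (path d).support
  edge_covered : ∀ e ∈ G.edgeSet, ∃ d : H.Dart, e ∈ (path d).edges

/-- `G` is a generalized Halin graph: it is obtained from a Halin graph `H` by subdividing (any
number of times, possibly zero) edges that do not belong to the outer boundary of `H`. -/
def IsGeneralizedHalin.{u} {W : Type u} (G : SimpleGraph W) : Prop :=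
  ∃ (V : Type u) (H : SimpleGraph V) (R : H.RotationSystem) (f : R.Face),
    H.IsEmbeddedHalin R f ∧
    ∃ S : Subdivision H G, ∀ d : H.Dart, d.edge ∈ R.faceEdges f → (S.path d).length = 1

end SimpleGraph

/-! Only horizontal extents matter. Scaling the heights of a planar straight-line drawing by a
factor `δ > 0` keeps it planar. If every edge has horizontal extent between 1 and 5, then a small
`δ` brings all lengths into `[1, 5 + ε]`, so the infimum is at most 5
(`Sketch.globalEdgeLengthRatio_le`). Heights are therefore free: a new vertex may be put so high
that its edges pass above everything drawn before, and it can be joined to any vertices with nothing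
above them (`Sketch.exists_insert`). What remains is to choose integer abscissae and an order of
insertion such that each vertex still to be joined stays visible.

A Halin graph is seen as an ordered tree hanging from an outer vertex `r`, together with the edges
between consecutive leaves and the edges from `r` to the first and last leaf. A branch below a
vertex `w` at abscissa `b - 1` or `b - 2` is drawn at abscissae at least `b`, so that everything
visible at or to the left of `w` stays visible. A path of unary vertices zigzags between `b` and `b
+ 1`. Where the tree first branches, the path to the first leaf is drawn bottom-up and the path to
the last leaf top-down, both zigzagging between `b + 1` and `b + 2`. All other branches hang off
these two paths to the right, with base `b + 3`. The last leaf ends at `b + 4` or before, hence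
within distance 5 of `w` if `w` is at `b - 1`. Structural induction on the forest gives
`Sketch.draw_all`.

The ordered tree comes from the rotation system. Euler's formula, and the fact that the faces are
connected across the edges outside a spanning tree (`eq_of_invariant`), show that each inner face
has exactly one edge on the outer face (`inner_facts`). By 3-connectivity the outer vertices are
leaves of the tree (`ncard_eq_one_of_mem_outer`). Hence the rotations order the leaves as the outer
face does, and the unique outer edge of the face between two neighbouring branches joins their
adjacent end leaves (`exists_orderedForest`). -/

open Filter

/-! ### Heights along lines and steep segments -/

/-- The height at abscissa `X` of the line through the points of `u` and `v`. -/
noncomputable def lineHeight {W : Type*} (x : W → ℤ) (y : W → ℝ) (u v : W) (X : ℝ) : ℝ :=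
  y u + (y v - y u) * ((X - x u) / (x v - x u))

section lineHeight

variable {W : Type*} {x : W → ℤ} {y : W → ℝ} {u v : W}

lemma lineHeight_left : lineHeight x y u v (x u) = y u := by simp [lineHeight]

lemma lineHeight_right (h : x u ≠ x v) : lineHeight x y u v (x v) = y v := by
  have : (x v : ℝ) - x u ≠ 0 := sub_ne_zero.2 (by exact_mod_cast h.symm)
  simp [lineHeight, this]

lemma lineHeight_symm (h : x u ≠ x v) (X : ℝ) : lineHeight x y u v X = lineHeight x y v u X := by
  have h1 : (x v : ℝ) - x u ≠ 0 := sub_ne_zero.2 (by exact_mod_cast h.symm)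
  have h2 : (x u : ℝ) - x v ≠ 0 := sub_ne_zero.2 (by exact_mod_cast h)
  simp only [lineHeight]
  field_simp
  ring

lemma div_sub_mem_Icc {a b X : ℝ} (h : a ≠ b) (hX : X ∈ Set.uIcc a b) :
    0 ≤ (X - a) / (b - a) ∧ (X - a) / (b - a) ≤ 1 := by
  rcases lt_or_gt_of_ne h with h | h
  · rw [Set.uIcc_of_le h.le] at hX
    exact ⟨div_nonneg (by linarith [hX.1]) (by linarith),
      (div_le_one (by linarith)).2 (by linarith [hX.2])⟩
  · rw [Set.uIcc_of_ge h.le] at hX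
    exact ⟨div_nonneg_of_nonpos (by linarith [hX.2]) (by linarith),
      (div_le_one_of_neg (by linarith)).2 (by linarith [hX.1])⟩

lemma lineHeight_lt (h : x u ≠ x v) {X M : ℝ} (hX : X ∈ Set.uIcc (x u : ℝ) (x v))
    (hu : y u < M) (hv : y v < M) : lineHeight x y u v X < M := by
  obtain ⟨h0, h1⟩ := div_sub_mem_Icc (by exact_mod_cast h) hX
  simp only [lineHeight]
  set τ := (X - (x u : ℝ)) / ((x v : ℝ) - x u)
  rcases h1.lt_or_eq with h1 | h1
  · nlinarith
  · rw [h1]; linarith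

lemma exists_lineHeight_eq (x : W → ℤ) (y : W → ℝ) (u v : W) :
    ∃ c s : ℝ, ∀ X, lineHeight x y u v X = c + s * X :=
  ⟨y u - (y v - y u) * x u / (x v - x u), (y v - y u) / (x v - x u), fun X => by
    simp only [lineHeight]; ring⟩

end lineHeight

/-- A steep segment from a point `(xq, yq)` that is not below the graph of an affine function over
an interval leaves that graph below itself. -/
lemma eventually_affine_lt {xq yq ξ α β c s : ℝ} (hne : ξ ≠ xq)
    (h : α ≤ xq → xq ≤ β → c + s * xq ≤ yq) :
    ∀ᶠ M : ℝ in atTop, ∀ X, α ≤ X → X ≤ β → X ∈ Set.uIcc xq ξ → X ≠ xq →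
      c + s * X < yq + (M - yq) * ((X - xq) / (ξ - xq)) := by
  have hd : ξ - xq ≠ 0 := sub_ne_zero.2 hne
  by_cases hq : α ≤ xq ∧ xq ≤ β
  -- The threshold is the height at `ξ` of the line of slope `s` through `(xq, yq)`. That line is
  -- not below the affine graph, and the segment is above it away from `xq`.
  · filter_upwards [eventually_gt_atTop (yq + s * (ξ - xq))] with M hM X _ _ hX hXq
    have h0 := (div_sub_mem_Icc hne.symm hX).1
    have hτ : X - xq = (X - xq) / (ξ - xq) * (ξ - xq) := by field_simp
    have hτ0 : (X - xq) / (ξ - xq) ≠ 0 := div_ne_zero (sub_ne_zero.2 hXq) hd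
    set τ := (X - xq) / (ξ - xq)
    have hpos : 0 < τ := lt_of_le_of_ne h0 hτ0.symm
    have h1 : c + s * X = c + s * xq + τ * (s * (ξ - xq)) := by
      have : X = xq + τ * (ξ - xq) := by linarith
      rw [this]; ring
    have h2 := h hq.1 hq.2
    nlinarith
  -- Here `xq` is outside the interval, so over the interval the segment has risen by at least a
  -- fixed fraction of `M - yq`, which eventually exceeds the bound `C` of the affine function.
  · obtain ⟨η, hη, hηX⟩ : ∃ η > 0, ∀ X, α ≤ X → X ≤ β → η ≤ |X - xq| := by
      rcases lt_or_ge xq α with h' | h'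
      · exact ⟨α - xq, by linarith, fun X h1 _ => (by linarith : α - xq ≤ X - xq).trans
          (le_abs_self _)⟩
      · have h'' : β < xq := by by_contra hh; exact hq ⟨h', not_lt.1 hh⟩
        exact ⟨xq - β, by linarith, fun X _ h1 => (by linarith : xq - β ≤ -(X - xq)).trans
          (neg_le_abs _)⟩
    have hL : 0 < |ξ - xq| := abs_pos.2 hd
    set C := c + |s| * (|α| + |β|)
    have hC : ∀ X, α ≤ X → X ≤ β → c + s * X ≤ C := by
      intro X h1 h2
      have hX : |X| ≤ |α| + |β| := by
        rw [abs_le]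
        constructor
        · linarith [neg_abs_le α, abs_nonneg β]
        · linarith [le_abs_self β, abs_nonneg α]
      have h3 : s * X ≤ |s| * |X| := by rw [← abs_mul]; exact le_abs_self _
      have h4 : |s| * |X| ≤ |s| * (|α| + |β|) := by gcongr
      simp only [C]; linarith
    filter_upwards [eventually_gt_atTop (yq + |C - yq| / (η / |ξ - xq|)),
      eventually_ge_atTop yq] with M hM hM' X h1 h2 hX _
    have h0 := (div_sub_mem_Icc hne.symm hX).1
    have hτ : η / |ξ - xq| ≤ (X - xq) / (ξ - xq) := by
      rw [← abs_of_nonneg h0, abs_div]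
      gcongr
      exact hηX X h1 h2
    have hp : 0 < η / |ξ - xq| := by positivity
    have h3 : |C - yq| < (M - yq) * (η / |ξ - xq|) := by
      rw [← div_lt_iff₀ hp]; linarith
    have h4 : (M - yq) * (η / |ξ - xq|) ≤ (M - yq) * ((X - xq) / (ξ - xq)) :=
      mul_le_mul_of_nonneg_left hτ (by linarith)
    linarith [hC X h1 h2, le_abs_self (C - yq)]

/-! ### Drawings that grow by one high vertex at a time -/

/-- A planar straight-line drawing, with integer abscissae, of a graph on finitely many vertices,
all of whose edges have a horizontal extent between `1` and `5`. -/
structure Sketch (W : Type*) where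
  verts : Finset W
  graph : SimpleGraph W
  x : W → ℤ
  y : W → ℝ
  mem_verts : ∀ ⦃u v⦄, graph.Adj u v → u ∈ verts
  extent : ∀ ⦃u v⦄, graph.Adj u v → 1 ≤ |x u - x v| ∧ |x u - x v| ≤ 5
  inj : ∀ ⦃u⦄, u ∈ verts → ∀ ⦃v⦄, v ∈ verts → x u = x v → y u = y v → u = v
  vertex_on_edge : ∀ ⦃u v a⦄, graph.Adj u v → a ∈ verts → (x a : ℝ) ∈ Set.uIcc (x u : ℝ) (x v) →
    lineHeight x y u v (x a) = y a → a = u ∨ a = v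
  edges_meet : ∀ ⦃u v z w⦄, graph.Adj u v → graph.Adj z w → s(u, v) ≠ s(z, w) →
    ∀ X : ℝ, X ∈ Set.uIcc (x u : ℝ) (x v) → X ∈ Set.uIcc (x z : ℝ) (x w) →
      lineHeight x y u v X = lineHeight x y z w X →
      ∃ c, (c = u ∨ c = v) ∧ (c = z ∨ c = w) ∧ X = x c

namespace Sketch

variable {W : Type*}

lemma x_ne (K : Sketch W) {u v : W} (h : K.graph.Adj u v) : K.x u ≠ K.x v := by
  intro he
  have := (K.extent h).1
  rw [he, sub_self, abs_zero] at this
  omega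

/-- No part of the drawing lies vertically above the vertex `a`. -/
def Visible (K : Sketch W) (a : W) : Prop :=
  a ∈ K.verts ∧ (∀ b ∈ K.verts, K.x b = K.x a → K.y b ≤ K.y a) ∧
    ∀ ⦃u v⦄, K.graph.Adj u v → (K.x a : ℝ) ∈ Set.uIcc (K.x u : ℝ) (K.x v) →
      lineHeight K.x K.y u v (K.x a) ≤ K.y a

lemma Visible.eq_of_x_eq {K : Sketch W} {a b : W} (ha : K.Visible a) (hb : K.Visible b)
    (h : K.x a = K.x b) : a = b :=
  K.inj ha.1 hb.1 h (le_antisymm (hb.2.1 a ha.1 h) (ha.2.1 b hb.1 h.symm))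

/-- `K'` arises from `K` by drawing further vertices and edges. -/
structure Extends (K K' : Sketch W) : Prop where
  verts : K.verts ⊆ K'.verts
  graph : K.graph ≤ K'.graph
  x_eq : ∀ a ∈ K.verts, K'.x a = K.x a

lemma Extends.trans {K K' K'' : Sketch W} (h : K.Extends K') (h' : K'.Extends K'') :
    K.Extends K'' :=
  ⟨h.verts.trans h'.verts, h.graph.trans h'.graph, fun a ha => by
    rw [h'.x_eq a (h.verts ha), h.x_eq a ha]⟩

/-- The drawing of a single vertex. -/
def single (r : W) (ξ : ℤ) : Sketch W where
  verts := {r}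
  graph := ⊥
  x := fun _ => ξ
  y := fun _ => 0
  mem_verts := by simp
  extent := by simp
  inj := by simp
  vertex_on_edge := by simp
  edges_meet := by simp

lemma visible_single (r : W) (ξ : ℤ) : (single r ξ).Visible r := by
  simp [Visible, single]

/-- A new vertex can be drawn high above everything else and be joined to visible vertices. -/
theorem exists_insert (K : Sketch W) {p : W} (hp : p ∉ K.verts) (ξ : ℤ) (Q : Set W)
    (hQ : ∀ q ∈ Q, K.Visible q ∧ 1 ≤ |ξ - K.x q| ∧ |ξ - K.x q| ≤ 5) :
    ∃ K' : Sketch W, K.Extends K' ∧ (∀ a, a ∈ K'.verts ↔ a = p ∨ a ∈ K.verts) ∧ K'.x p = ξ ∧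
      K'.Visible p ∧ (∀ q ∈ Q, K'.graph.Adj p q) ∧
      ∀ a, K.Visible a → K.x a ≠ ξ →
        (∀ q ∈ Q, (K.x a < ξ ∧ K.x a ≤ K.x q) ∨ (ξ < K.x a ∧ K.x q ≤ K.x a)) → K'.Visible a := by
  classical
  have hQne : ∀ q ∈ Q, K.x q ≠ ξ := by
    intro q hq he
    have := (hQ q hq).2.1
    rw [he, sub_self, abs_zero] at this
    omega
  have hQv : ∀ q ∈ Q, q ∈ K.verts := fun q hq => (hQ q hq).1.1
  -- Four conditions hold for all large heights `M`: the new vertex is above all old ones; its edges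
  -- pass above the old edges, and above the old vertices, except at their lower ends; and it is not
  -- collinear with two old vertices of different abscissae, so that its edges do not overlap.
  have ev1 : ∀ᶠ M : ℝ in atTop, ∀ a ∈ K.verts, K.y a < M :=
    (Filter.eventually_all_finset _).2 fun a _ => eventually_gt_atTop _
  have ev2 : ∀ᶠ M : ℝ in atTop, ∀ q ∈ K.verts, ∀ u ∈ K.verts, ∀ v ∈ K.verts,
      q ∈ Q → K.graph.Adj u v → ∀ X ∈ Set.uIcc (K.x u : ℝ) (K.x v),
        X ∈ Set.uIcc (K.x q : ℝ) ξ → X ≠ K.x q →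
        lineHeight K.x K.y u v X < K.y q + (M - K.y q) * ((X - K.x q) / (ξ - K.x q)) := by
    refine (Filter.eventually_all_finset _).2 fun q _ => (Filter.eventually_all_finset _).2
      fun u _ => (Filter.eventually_all_finset _).2 fun v _ => ?_
    by_cases hh : q ∈ Q ∧ K.graph.Adj u v
    · obtain ⟨c, s, hcs⟩ := exists_lineHeight_eq K.x K.y u v
      have := eventually_affine_lt (xq := K.x q) (yq := K.y q) (ξ := ξ)
        (α := min (K.x u : ℝ) (K.x v)) (β := max (K.x u : ℝ) (K.x v)) (c := c) (s := s)
        (by exact_mod_cast (hQne q hh.1).symm)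
        (fun h1 h2 => by rw [← hcs]; exact (hQ q hh.1).1.2.2 hh.2 ⟨h1, h2⟩)
      filter_upwards [this] with M hM _ _ X hX hX' hne
      rw [hcs]
      exact hM X hX.1 hX.2 hX' hne
    · exact Eventually.of_forall fun M h1 h2 => absurd ⟨h1, h2⟩ hh
  have ev3 : ∀ᶠ M : ℝ in atTop, ∀ q ∈ K.verts, ∀ a ∈ K.verts, q ∈ Q →
        (K.x a : ℝ) ∈ Set.uIcc (K.x q : ℝ) ξ → (K.x a : ℝ) ≠ K.x q →
        K.y a < K.y q + (M - K.y q) * (((K.x a : ℝ) - K.x q) / (ξ - K.x q)) := by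
    refine (Filter.eventually_all_finset _).2 fun q _ => (Filter.eventually_all_finset _).2
      fun a ha => ?_
    by_cases hh : q ∈ Q
    · have := eventually_affine_lt (xq := K.x q) (yq := K.y q) (ξ := ξ)
        (α := K.x a) (β := K.x a) (c := K.y a) (s := 0)
        (by exact_mod_cast (hQne q hh).symm)
        (fun h1 h2 => by
          rw [zero_mul, add_zero]
          exact (hQ q hh).1.2.1 a ha (by exact_mod_cast le_antisymm h1 h2))
      filter_upwards [this] with M hM _ hX' hne
      simpa using hM (K.x a) le_rfl le_rfl hX' hne
    · exact Eventually.of_forall fun M h1 => absurd h1 hh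
  have ev4 : ∀ᶠ M : ℝ in atTop, ∀ q ∈ K.verts, ∀ q' ∈ K.verts, K.x q ≠ K.x q' →
      (M - K.y q) * ((ξ : ℝ) - K.x q') ≠ (M - K.y q') * ((ξ : ℝ) - K.x q) := by
    refine (Filter.eventually_all_finset _).2 fun q _ => (Filter.eventually_all_finset _).2
      fun q' _ => ?_
    by_cases hne : K.x q = K.x q'
    · exact Eventually.of_forall fun M h1 => absurd hne h1
    · have hne' : (K.x q : ℝ) - K.x q' ≠ 0 := sub_ne_zero.2 (by exact_mod_cast hne)
      filter_upwards [eventually_ne_atTop ((K.y q * (ξ - K.x q') - K.y q' * (ξ - K.x q)) /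
        ((K.x q : ℝ) - K.x q'))] with M hM _ he
      apply hM
      rw [eq_div_iff hne']
      linarith
  obtain ⟨M, hM1, hM2, hM3, hM4⟩ := (ev1.and (ev2.and (ev3.and ev4))).exists
  set x' := Function.update K.x p ξ with hx'
  set y' := Function.update K.y p M with hy'
  have hne : ∀ a ∈ K.verts, a ≠ p := fun a ha h => hp (h ▸ ha)
  have xo : ∀ a ∈ K.verts, x' a = K.x a := fun a ha => Function.update_of_ne (hne a ha) _ _
  have yo : ∀ a ∈ K.verts, y' a = K.y a := fun a ha => Function.update_of_ne (hne a ha) _ _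
  have xp : x' p = ξ := Function.update_self ..
  have yp : y' p = M := Function.update_self ..
  have ho : ∀ u ∈ K.verts, ∀ v ∈ K.verts, ∀ X, lineHeight x' y' u v X = lineHeight K.x K.y u v X :=
    fun u hu v hv X => by simp only [lineHeight, xo u hu, xo v hv, yo u hu, yo v hv]
  have hn : ∀ q ∈ Q, ∀ X, lineHeight x' y' q p X =
      K.y q + (M - K.y q) * ((X - K.x q) / (ξ - K.x q)) :=
    fun q hq X => by simp only [lineHeight, xo q (hQv q hq), yo q (hQv q hq), xp, yp]
  let G' : SimpleGraph W :=
    { Adj := fun u v => K.graph.Adj u v ∨ (u = p ∧ v ∈ Q) ∨ (v = p ∧ u ∈ Q)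
      symm := ⟨fun u v h => by
        rcases h with h | h | h
        · exact Or.inl h.symm
        · exact Or.inr (Or.inr h)
        · exact Or.inr (Or.inl h)⟩
      loopless := ⟨fun u h => by
        rcases h with h | ⟨h, h'⟩ | ⟨h, h'⟩
        · exact h.ne rfl
        · exact hne u (hQv u h') h
        · exact hne u (hQv u h') h⟩ }
  have mem2 : ∀ {u v}, K.graph.Adj u v → u ∈ K.verts ∧ v ∈ K.verts :=
    fun h => ⟨K.mem_verts h, K.mem_verts h.symm⟩
  have xne : ∀ {u v}, G'.Adj u v → x' u ≠ x' v := by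
    rintro u v (h | ⟨rfl, h⟩ | ⟨rfl, h⟩)
    · rw [xo u (mem2 h).1, xo v (mem2 h).2]; exact K.x_ne h
    · rw [xp, xo v (hQv v h)]; exact (hQne v h).symm
    · rw [xp, xo u (hQv u h)]; exact (hQne u h)
  have hext : ∀ ⦃u v⦄, G'.Adj u v → 1 ≤ |x' u - x' v| ∧ |x' u - x' v| ≤ 5 := by
    rintro u v (h | ⟨rfl, h⟩ | ⟨rfl, h⟩)
    · rw [xo u (mem2 h).1, xo v (mem2 h).2]; exact K.extent h
    · rw [xp, xo v (hQv v h)]; exact (hQ v h).2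
    · rw [xp, xo u (hQv u h), abs_sub_comm]; exact (hQ u h).2
  have hinj : ∀ ⦃u⦄, u ∈ insert p K.verts → ∀ ⦃v⦄, v ∈ insert p K.verts →
      x' u = x' v → y' u = y' v → u = v := by
    intro u hu v hv h1 h2
    rw [Finset.mem_insert] at hu hv
    rcases hu with rfl | hu <;> rcases hv with rfl | hv
    · rfl
    · rw [yp, yo v hv] at h2; exact absurd h2 (hM1 v hv).ne'
    · rw [yp, yo u hu] at h2; exact absurd h2 (hM1 u hu).ne
    · rw [xo u hu, xo v hv] at h1
      rw [yo u hu, yo v hv] at h2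
      exact K.inj hu hv h1 h2
  have newv : ∀ q ∈ Q, ∀ a ∈ insert p K.verts, (x' a : ℝ) ∈ Set.uIcc (x' q : ℝ) (x' p) →
      lineHeight x' y' q p (x' a) = y' a → a = q ∨ a = p := by
    intro q hq a ha hX hh
    rw [Finset.mem_insert] at ha
    rcases ha with rfl | ha
    · exact Or.inr rfl
    · left
      rw [hn q hq, xo a ha, yo a ha] at hh
      rw [xo q (hQv q hq), xp, xo a ha] at hX
      by_cases he : (K.x a : ℝ) = K.x q
      · rw [he] at hh
        simp only [sub_self, zero_div, mul_zero, add_zero] at hh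
        exact K.inj ha (hQv q hq) (by exact_mod_cast he) hh.symm
      · exact absurd hh (hM3 q (hQv q hq) a ha hq hX he).ne'
  have hvert : ∀ ⦃u v a⦄, G'.Adj u v → a ∈ insert p K.verts →
      (x' a : ℝ) ∈ Set.uIcc (x' u : ℝ) (x' v) → lineHeight x' y' u v (x' a) = y' a →
      a = u ∨ a = v := by
    rintro u v a hadj ha hX hh
    have hxne := xne hadj
    rcases hadj with h | ⟨rfl, h⟩ | ⟨rfl, h⟩
    · obtain ⟨hu, hv⟩ := mem2 h
      rw [Finset.mem_insert] at ha
      rcases ha with rfl | ha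
      · exfalso
        rw [ho u hu v hv, yp] at hh
        rw [xo u hu, xo v hv] at hX
        exact (lineHeight_lt (K.x_ne h) hX (hM1 u hu) (hM1 v hv)).ne hh
      · rw [ho u hu v hv, yo a ha, xo a ha] at hh
        rw [xo u hu, xo v hv, xo a ha] at hX
        exact K.vertex_on_edge h ha hX hh
    · rw [lineHeight_symm hxne] at hh
      rw [Set.uIcc_comm] at hX
      exact (newv v h a ha hX hh).symm
    · exact newv u h a ha hX hh
  have oldnew : ∀ q ∈ Q, ∀ ⦃u v⦄, K.graph.Adj u v → ∀ X : ℝ,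
      X ∈ Set.uIcc (x' q : ℝ) (x' p) → X ∈ Set.uIcc (x' u : ℝ) (x' v) →
      lineHeight x' y' q p X = lineHeight x' y' u v X →
      ∃ c, (c = q ∨ c = p) ∧ (c = u ∨ c = v) ∧ X = x' c := by
    intro q hq u v h X hX hX' hh
    obtain ⟨hu, hv⟩ := mem2 h
    rw [hn q hq, ho u hu v hv] at hh
    rw [xo q (hQv q hq), xp] at hX
    rw [xo u hu, xo v hv] at hX'
    have hXq : X = K.x q := by
      by_contra he
      exact (hM2 q (hQv q hq) u hu v hv hq h X hX' hX he).ne' hh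
    subst hXq
    simp only [sub_self, zero_div, mul_zero, add_zero] at hh
    exact ⟨q, Or.inl rfl, K.vertex_on_edge h (hQv q hq) hX' hh.symm, by rw [xo q (hQv q hq)]⟩
  have newnew : ∀ q ∈ Q, ∀ q' ∈ Q, q ≠ q' → ∀ X : ℝ,
      lineHeight x' y' q p X = lineHeight x' y' q' p X → X = x' p := by
    intro q hq q' hq' hqq X hh
    rw [hn q hq, hn q' hq'] at hh
    rw [xp]
    by_contra hX
    have d1 : (ξ : ℝ) - K.x q ≠ 0 := sub_ne_zero.2 (by exact_mod_cast (hQne q hq).symm)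
    have d2 : (ξ : ℝ) - K.x q' ≠ 0 := sub_ne_zero.2 (by exact_mod_cast (hQne q' hq').symm)
    have d3 : (ξ : ℝ) - X ≠ 0 := sub_ne_zero.2 (Ne.symm hX)
    have key : (M - K.y q) * ((ξ : ℝ) - K.x q') = (M - K.y q') * ((ξ : ℝ) - K.x q) := by
      have e1 : K.y q + (M - K.y q) * ((X - K.x q) / (ξ - K.x q)) =
          M - (M - K.y q) * ((ξ - X) / (ξ - K.x q)) := by field_simp; ring
      have e2 : K.y q' + (M - K.y q') * ((X - K.x q') / (ξ - K.x q')) =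
          M - (M - K.y q') * ((ξ - X) / (ξ - K.x q')) := by field_simp; ring
      rw [e1, e2] at hh
      have hh' : (M - K.y q) * ((ξ - X) / (ξ - K.x q)) =
        (M - K.y q') * ((ξ - X) / (ξ - K.x q')) := by linarith
      field_simp at hh'
      linarith
    by_cases he : K.x q = K.x q'
    · rw [he] at key
      have := mul_right_cancel₀ d2 key
      exact hqq (K.inj (hQv q hq) (hQv q' hq') he (by linarith))
    · exact hM4 q (hQv q hq) q' (hQv q' hq') he key
  have hmeet : ∀ ⦃u v z w⦄, G'.Adj u v → G'.Adj z w → s(u, v) ≠ s(z, w) →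
      ∀ X : ℝ, X ∈ Set.uIcc (x' u : ℝ) (x' v) → X ∈ Set.uIcc (x' z : ℝ) (x' w) →
      lineHeight x' y' u v X = lineHeight x' y' z w X →
      ∃ c, (c = u ∨ c = v) ∧ (c = z ∨ c = w) ∧ X = x' c := by
    have new : ∀ q ∈ Q, ∀ ⦃z w⦄, G'.Adj z w → s(q, p) ≠ s(z, w) →
        ∀ X : ℝ, X ∈ Set.uIcc (x' q : ℝ) (x' p) → X ∈ Set.uIcc (x' z : ℝ) (x' w) →
        lineHeight x' y' q p X = lineHeight x' y' z w X →
        ∃ c, (c = q ∨ c = p) ∧ (c = z ∨ c = w) ∧ X = x' c := by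
      intro q hq z w hzw hs X h1 h2 hh
      have hxne := xne hzw
      rcases hzw with h | ⟨rfl, h⟩ | ⟨rfl, h⟩
      · exact oldnew q hq h X h1 h2 hh
      · rw [lineHeight_symm hxne] at hh
        exact ⟨z, Or.inr rfl, Or.inl rfl,
          newnew q hq w h (fun he => hs (by rw [he, Sym2.eq_swap])) X hh⟩
      · exact ⟨w, Or.inr rfl, Or.inr rfl, newnew q hq z h (fun he => hs (by rw [he])) X hh⟩
    intro u v z w huv hzw hs X h1 h2 hh
    have hxne := xne huv
    rcases huv with h | ⟨rfl, h⟩ | ⟨rfl, h⟩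
    · have hxne' := xne hzw
      rcases hzw with h' | ⟨rfl, h'⟩ | ⟨rfl, h'⟩
      · obtain ⟨hu, hv⟩ := mem2 h
        obtain ⟨hz, hw⟩ := mem2 h'
        rw [ho u hu v hv, ho z hz w hw] at hh
        rw [xo u hu, xo v hv] at h1
        rw [xo z hz, xo w hw] at h2
        obtain ⟨c, hc1, hc2, hc3⟩ := K.edges_meet h h' hs X h1 h2 hh
        refine ⟨c, hc1, hc2, ?_⟩
        rw [hc3, xo c (by rcases hc1 with rfl | rfl <;> assumption)]
      · rw [lineHeight_symm hxne'] at hh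
        rw [Set.uIcc_comm] at h2
        obtain ⟨c, hc1, hc2, hc3⟩ := oldnew w h' h X h2 h1 hh.symm
        exact ⟨c, hc2, hc1.symm, hc3⟩
      · obtain ⟨c, hc1, hc2, hc3⟩ := oldnew z h' h X h2 h1 hh.symm
        exact ⟨c, hc2, hc1, hc3⟩
    · rw [lineHeight_symm hxne] at hh
      rw [Set.uIcc_comm] at h1
      obtain ⟨c, hc1, hc2, hc3⟩ := new v h hzw (by rwa [Sym2.eq_swap]) X h1 h2 hh
      exact ⟨c, hc1.symm, hc2, hc3⟩
    · exact new u h hzw hs X h1 h2 hh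
  let K' : Sketch W :=
    { verts := insert p K.verts
      graph := G'
      x := x'
      y := y'
      mem_verts := by
        rintro u v (h | ⟨rfl, h⟩ | ⟨rfl, h⟩)
        · exact Finset.mem_insert_of_mem (mem2 h).1
        · exact Finset.mem_insert_self ..
        · exact Finset.mem_insert_of_mem (hQv u h)
      extent := hext
      inj := hinj
      vertex_on_edge := hvert
      edges_meet := hmeet }
  refine ⟨K', ⟨Finset.subset_insert _ _, fun u v h => Or.inl h, xo⟩,
    fun a => Finset.mem_insert, xp, ⟨Finset.mem_insert_self .., ?_, ?_⟩,
    fun q hq => Or.inr (Or.inl ⟨rfl, hq⟩), ?_⟩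
  · intro b hb _
    change y' b ≤ y' p
    rcases Finset.mem_insert.1 hb with rfl | hb
    · rfl
    · rw [yo b hb, yp]; exact (hM1 b hb).le
  · intro u v hadj hX
    change lineHeight x' y' u v (x' p) ≤ y' p
    change (x' p : ℝ) ∈ Set.uIcc (x' u : ℝ) (x' v) at hX
    have hxne := xne hadj
    rcases hadj with h | ⟨rfl, h⟩ | ⟨rfl, h⟩
    · obtain ⟨hu, hv⟩ := mem2 h
      rw [ho u hu v hv, yp]
      rw [xo u hu, xo v hv] at hX
      exact (lineHeight_lt (K.x_ne h) hX (hM1 u hu) (hM1 v hv)).le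
    · rw [lineHeight_left]
    · rw [lineHeight_right hxne]
  · intro a ha hξ hq
    have hax := xo a ha.1
    have newa : ∀ q ∈ Q, (x' a : ℝ) ∈ Set.uIcc (x' q : ℝ) (x' p) →
        lineHeight x' y' q p (x' a) ≤ y' a := by
      intro q hq' hX
      have hqx := xo q (hQv q hq')
      -- The condition on `a` keeps it out of the extent of the new edge except at the lower end,
      -- and two visible vertices on one vertical line coincide.
      have : K.x a = K.x q := by
        rw [hax, hqx, xp, Set.mem_uIcc] at hX
        norm_cast at hX
        rcases hq q hq' with h | h <;> omega
      have := ha.eq_of_x_eq (hQ q hq').1 this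
      subst this
      rw [lineHeight_left]
    refine ⟨Finset.mem_insert_of_mem ha.1, ?_, ?_⟩
    · intro b hb hba
      change x' b = x' a at hba
      change y' b ≤ y' a
      rcases Finset.mem_insert.1 hb with rfl | hb
      · rw [xp, hax] at hba; exact absurd hba.symm hξ
      · rw [xo b hb, hax] at hba
        rw [yo b hb, yo a ha.1]
        exact ha.2.1 b hb hba
    · intro u v hadj hX
      change lineHeight x' y' u v (x' a) ≤ y' a
      change (x' a : ℝ) ∈ Set.uIcc (x' u : ℝ) (x' v) at hX
      have hxne := xne hadj
      rcases hadj with h | ⟨rfl, h⟩ | ⟨rfl, h⟩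
      · obtain ⟨hu, hv⟩ := mem2 h
        rw [ho u hu v hv, yo a ha.1, hax]
        rw [xo u hu, xo v hv, hax] at hX
        exact ha.2.2 h hX
      · rw [lineHeight_symm hxne]
        rw [Set.uIcc_comm] at hX
        exact newa v h hX
      · exact newa u h hX

end Sketch


/-! ### Ordered forests and the edges between consecutive leaves -/

/-- An ordered forest: `cons w c s` has a first tree with root `w`, whose subtrees are those of
`c`, and `s` consists of the other trees. -/
inductive OrderedForest (W : Type*)
  | nil : OrderedForest W
  | cons : W → OrderedForest W → OrderedForest W → OrderedForest W

namespace OrderedForest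

variable {W : Type*}

/-- The vertices of an ordered forest. -/
def labels : OrderedForest W → List W
  | nil => []
  | cons w c s => w :: (c.labels ++ s.labels)

/-- The first leaf, with a default value for the empty forest. -/
def firstLeaf : OrderedForest W → W → W
  | nil, d => d
  | cons w c _, _ => c.firstLeaf w

/-- The last leaf, with a default value for the empty forest. -/
def lastLeaf : OrderedForest W → W → W
  | nil, d => d
  | cons w c s, _ => s.lastLeaf (c.lastLeaf w)

lemma lastLeaf_eq {f : OrderedForest W} (h : f ≠ nil) (d d' : W) :
    f.lastLeaf d = f.lastLeaf d' := by
  cases f with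
  | nil => exact absurd rfl h
  | cons w c s => rfl

/-- The edge between an optional vertex and a vertex. -/
def optionEdge : Option W → W → Set (Sym2 W)
  | none, _ => ∅
  | some p, w => {s(p, w)}

/-- The edges of an ordered forest whose roots are joined to `v`, together with the edges between
consecutive leaves, where the leaf before the first one is given by the last argument. -/
def edges : OrderedForest W → W → Option W → Set (Sym2 W)
  | nil, _, _ => ∅
  | cons w c s, v, p =>
    insert s(v, w) (optionEdge p (c.firstLeaf w) ∪ c.edges w none ∪
      s.edges v (some (c.lastLeaf w)))

lemma edges_none_subset (f : OrderedForest W) (v : W) (p : Option W) :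
    f.edges v none ⊆ f.edges v p := by
  cases f with
  | nil => exact subset_rfl
  | cons w c s =>
    simp only [edges, optionEdge, Set.empty_union]
    gcongr
    exact Set.subset_union_right

end OrderedForest

/-- The edges of the path that leads from `w` through the vertices of `l`, the last one first,
to `u`. -/
def chainEdges {W : Type*} (w : W) : List W → W → Set (Sym2 W)
  | [], u => {s(w, u)}
  | s :: l, u => insert s(s, u) (chainEdges w l s)

/-! ### Choice of the abscissae by recursion on the forest -/

namespace Sketch

open OrderedForest

variable {W : Type*}

/-- The abscissae at which the last leaf of a subtree may be drawn. -/
def Near (b ξ : ℤ) : Prop := ξ = b ∨ ξ = b + 2 ∨ ξ = b + 4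

lemma one_le_abs_and_le {t : ℤ} (h : (1 ≤ t ∧ t ≤ 5) ∨ (-5 ≤ t ∧ t ≤ -1)) :
    1 ≤ |t| ∧ |t| ≤ 5 := by
  rw [le_abs, abs_le]
  omega

/-- A zigzag path between two neighbouring abscissae. -/
lemma exists_trunk (b : ℤ) (w : W) (l : List W) : ∀ (K : Sketch W) (ξ : ℤ),
    (ξ = b ∨ ξ = b + 1) → K.Visible w → (K.x w = b - 1 ∨ K.x w = b - 2) → l.Nodup →
    (∀ z ∈ l, z ∉ K.verts) →
    ∃ K' : Sketch W, K.Extends K' ∧ (∀ z, z ∈ K'.verts ↔ z ∈ K.verts ∨ z ∈ l) ∧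
      K'.Visible (l.headD w) ∧ (l = [] ∨ K'.x (l.headD w) = ξ) ∧
      (∀ u (K'' : Sketch W), K'.Extends K'' → K''.graph.Adj (l.headD w) u →
        chainEdges w l u ⊆ K''.graph.edgeSet) ∧
      ∀ z, K.Visible z → (K.x z ≤ K.x w ∨ b + 2 ≤ K.x z) → K'.Visible z := by
  induction l with
  | nil =>
    intro K ξ _ hw _ _ _
    refine ⟨K, ⟨subset_rfl, le_rfl, fun _ _ => rfl⟩, by simp, hw, Or.inl rfl, ?_,
      fun z hz _ => hz⟩
    intro u K'' _ h
    simpa [chainEdges] using h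
  | cons p l ih =>
    intro K ξ hξ hw hxw hnd hfresh
    have hnd' := List.nodup_cons.1 hnd
    -- The map `ξ ↦ 2 * b + 1 - ξ` swaps `b` and `b + 1`, so that neighbours on the path alternate.
    obtain ⟨K1, hK1, hv1, hvis1, htop, hch, hprot⟩ := ih K (2 * b + 1 - ξ) (by omega) hw hxw
      hnd'.2 fun z hz => hfresh z (List.mem_cons_of_mem _ hz)
    have hxw1 := hK1.x_eq w hw.1
    have hp : p ∉ K1.verts := by
      rw [hv1]
      rintro (h | h)
      · exact hfresh p List.mem_cons_self h
      · exact hnd'.1 h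
    have htopx : K1.x (l.headD w) = K.x w ∧ l.headD w = w ∨ K1.x (l.headD w) = 2 * b + 1 - ξ := by
      rcases htop with h | h
      · subst h
        exact Or.inl ⟨hxw1, rfl⟩
      · exact Or.inr h
    obtain ⟨K2, hK2, hv2, hx2, hvis2, hadj, hprot2⟩ := K1.exists_insert hp ξ {l.headD w}
      (by
        rintro q rfl
        exact ⟨hvis1, one_le_abs_and_le (by omega)⟩)
    refine ⟨K2, hK1.trans hK2, ?_, hvis2, Or.inr hx2, ?_, ?_⟩
    · intro z
      rw [hv2, hv1, List.mem_cons]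
      tauto
    · intro u K'' hK'' hu
      simp only [chainEdges]
      exact Set.insert_subset hu (hch _ K'' (hK2.trans hK'') (hK''.graph (hadj _ rfl).symm))
    · intro z hz hxz
      have hz1 := hprot z hz hxz
      have hxz1 := hK1.x_eq z hz.1
      refine hprot2 z hz1 (by omega) ?_
      rintro q rfl
      omega

/-- Drawing the path through the vertices of `l` and then its end-vertex `u`, which has also
the neighbour `c`. -/
lemma exists_trunk_top {b : ℤ} {w u c : W} {l : List W} {K : Sketch W} (hw : K.Visible w)
    (hc : K.Visible c) (hxw : K.x w = b - 1 ∨ K.x w = b - 2)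
    (hxc : b + 2 ≤ K.x c ∧ K.x c ≤ b + 4) (hnd : (l ++ [u]).Nodup)
    (hfresh : ∀ z ∈ l ++ [u], z ∉ K.verts) :
    ∃ K' : Sketch W, K.Extends K' ∧ (∀ z, z ∈ K'.verts ↔ z ∈ K.verts ∨ z ∈ l ++ [u]) ∧
      K'.Visible u ∧ K'.x u = b + 1 ∧ chainEdges w l u ⊆ K'.graph.edgeSet ∧
      K'.graph.Adj u c ∧
      ∀ z, K.Visible z → (K.x z ≤ K.x w ∨ K.x c ≤ K.x z) → K'.Visible z := by
  obtain ⟨K1, hK1, hv1, hvis1, htop, hch, hprot⟩ := exists_trunk b w l K b (Or.inl rfl) hw hxw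
    (List.nodup_append.1 hnd).1 fun z hz => hfresh z (List.mem_append_left _ hz)
  have hxw1 := hK1.x_eq w hw.1
  have hxc1 := hK1.x_eq c hc.1
  have hc1 := hprot c hc (by omega)
  have hu : u ∉ K1.verts := by
    rw [hv1]
    rintro (h | h)
    · exact hfresh u (by simp) h
    · exact (List.nodup_append.1 hnd).2.2 u h u (by simp) rfl
  have htopx : K1.x (l.headD w) = K.x w ∧ l.headD w = w ∨ K1.x (l.headD w) = b := by
    rcases htop with h | h
    · subst h
      exact Or.inl ⟨hxw1, rfl⟩
    · exact Or.inr h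
  obtain ⟨K2, hK2, hv2, hx2, hvis2, hadj, hprot2⟩ := K1.exists_insert hu (b + 1)
    {l.headD w, c}
    (by
      rintro q (rfl | rfl)
      · exact ⟨hvis1, one_le_abs_and_le (by omega)⟩
      · exact ⟨hc1, one_le_abs_and_le (by omega)⟩)
  refine ⟨K2, hK1.trans hK2, ?_, hvis2, hx2, hch _ K2 hK2 (hadj _ (by simp)).symm,
    hadj _ (by simp), ?_⟩
  · intro z
    rw [hv2, hv1, List.mem_append, List.mem_singleton]
    tauto
  · intro z hz hxz
    have hz1 := hprot z hz (by omega)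
    have hxz1 := hK1.x_eq z hz.1
    refine hprot2 z hz1 (by omega) ?_
    rintro q (rfl | rfl) <;> omega

variable (f : OrderedForest W)

/-- The tree with root `a` and subtrees `f`, at the end of a path through `l` that starts at the
vertex `w`, can be drawn to the right of `w`. -/
def DrawTree : Prop :=
  ∀ (K : Sketch W) (a : W) (l : List W) (b : ℤ) (w p : W), K.Visible w → K.Visible p →
    (K.x w = b - 1 ∨ K.x w = b - 2) → (Near b (K.x p) ∨ (p = w ∧ K.x p = b - 1)) →
    (l ++ a :: f.labels).Nodup → (∀ z ∈ l ++ a :: f.labels, z ∉ K.verts) →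
    ∃ K' : Sketch W, K.Extends K' ∧
      (∀ z, z ∈ K'.verts ↔ z ∈ K.verts ∨ z ∈ l ++ a :: f.labels) ∧
      chainEdges w l a ⊆ K'.graph.edgeSet ∧ K'.graph.Adj p (f.firstLeaf a) ∧
      f.edges a none ⊆ K'.graph.edgeSet ∧ K'.Visible (f.lastLeaf a) ∧
      Near b (K'.x (f.lastLeaf a)) ∧ (∀ z, K.Visible z → K.x z ≤ K.x w → K'.Visible z) ∧
      (K.x w = b - 1 → K'.graph.Adj w (f.lastLeaf a))

/-- The tree with root `a` and subtrees `f` can be drawn so that the path to its first leaf forms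
the lower part of the left boundary. -/
def DrawLower : Prop :=
  ∀ (K : Sketch W) (a : W) (b ξ : ℤ) (w p : W), K.Visible w → K.Visible p →
    (K.x w = b - 1 ∨ K.x w = b - 2) → (Near b (K.x p) ∨ (p = w ∧ K.x p = b - 1)) →
    (ξ = b + 1 ∨ ξ = b + 2) →
    (a :: f.labels).Nodup → (∀ z ∈ a :: f.labels, z ∉ K.verts) →
    ∃ K' : Sketch W, K.Extends K' ∧ (∀ z, z ∈ K'.verts ↔ z ∈ K.verts ∨ z ∈ a :: f.labels) ∧
      K'.graph.Adj p (f.firstLeaf a) ∧ f.edges a none ⊆ K'.graph.edgeSet ∧ K'.Visible a ∧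
      (f = nil ∧ K'.x a = b + 3 ∨ f ≠ nil ∧ K'.x a = ξ) ∧ K'.Visible (f.lastLeaf a) ∧
      Near (b + 3) (K'.x (f.lastLeaf a)) ∧ (∀ z, K.Visible z → K.x z ≤ K.x w → K'.Visible z)

/-- The forest `f` can be drawn so that the path from `v` to its last leaf forms the upper part of
the left boundary. -/
def DrawUpper : Prop :=
  f ≠ nil → ∀ (K : Sketch W) (b : ℤ) (v w p : W), K.Visible v → K.Visible w → K.Visible p →
    (K.x v = b + 1 ∨ K.x v = b + 2) → (K.x w = b - 1 ∨ K.x w = b - 2) → Near (b + 3) (K.x p) →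
    f.labels.Nodup → (∀ z ∈ f.labels, z ∉ K.verts) →
    ∃ K' : Sketch W, K.Extends K' ∧ (∀ z, z ∈ K'.verts ↔ z ∈ K.verts ∨ z ∈ f.labels) ∧
      f.edges v (some p) ⊆ K'.graph.edgeSet ∧ K'.Visible (f.lastLeaf p) ∧
      K'.x (f.lastLeaf p) = b + 4 ∧ (∀ z, K.Visible z → K.x z ≤ K.x w → K'.Visible z) ∧
      (K.x w = b - 1 → K'.graph.Adj w (f.lastLeaf p))

/-- The trees of the forest `f` can be drawn one after the other to the right of `v`. -/
def DrawForest : Prop :=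
  ∀ (K : Sketch W) (b : ℤ) (v p : W), K.Visible v → K.Visible p →
    (K.x v = b - 1 ∨ K.x v = b - 2) → Near b (K.x p) →
    f.labels.Nodup → (∀ z ∈ f.labels, z ∉ K.verts) →
    ∃ K' : Sketch W, K.Extends K' ∧ (∀ z, z ∈ K'.verts ↔ z ∈ K.verts ∨ z ∈ f.labels) ∧
      f.edges v (some p) ⊆ K'.graph.edgeSet ∧ K'.Visible (f.lastLeaf p) ∧
      Near b (K'.x (f.lastLeaf p)) ∧ (∀ z, K.Visible z → K.x z ≤ K.x v → K'.Visible z)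

variable {f} {c s : OrderedForest W} {a : W}

lemma drawForest_nil : DrawForest (nil : OrderedForest W) := by
  intro K b v p _ hp _ hxp _ _
  exact ⟨K, ⟨subset_rfl, le_rfl, fun _ _ => rfl⟩, by simp [labels], by simp [edges], hp, hxp,
    fun z hz _ => hz⟩

lemma nodup_cons_labels (h : (cons a c s).labels.Nodup) :
    (a :: c.labels).Nodup ∧ s.labels.Nodup ∧ ∀ z ∈ s.labels, z ∉ a :: c.labels := by
  have h' : ((a :: c.labels) ++ s.labels).Nodup := h
  obtain ⟨h1, h2, h3⟩ := List.nodup_append.1 h'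
  exact ⟨h1, h2, fun z hz hz' => h3 z hz' z hz rfl⟩

lemma mem_labels_cons {z : W} : z ∈ (cons a c s).labels ↔ z ∈ a :: c.labels ∨ z ∈ s.labels := by
  simp [labels, or_assoc]

lemma edgeSet_mono {K K' : Sketch W} (h : K.Extends K') {A : Set (Sym2 W)}
    (hA : A ⊆ K.graph.edgeSet) : A ⊆ K'.graph.edgeSet :=
  hA.trans (SimpleGraph.edgeSet_mono h.graph)

lemma drawForest_cons (hc : DrawTree c) (hs : DrawForest s) : DrawForest (cons a c s) := by
  intro K b v p hv hp hxv hxp hnd hfresh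
  obtain ⟨nd1, nd2, nd3⟩ := nodup_cons_labels hnd
  obtain ⟨K1, hK1, hv1, hch, hadj, hed, hvis, hnear, hprot, -⟩ := hc K a [] b v p hv hp hxv
    (Or.inl hxp) nd1 fun z hz => hfresh z (mem_labels_cons.2 (Or.inl hz))
  have hxv1 := hK1.x_eq v hv.1
  obtain ⟨K2, hK2, hv2, hed2, hvis2, hnear2, hprot2⟩ := hs K1 b v _ (hprot v hv le_rfl) hvis
    (by rwa [hxv1]) hnear nd2 (fun z hz => by
      rw [hv1]
      rintro (h | h)
      · exact hfresh z (mem_labels_cons.2 (Or.inr hz)) h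
      · exact nd3 z hz h)
  refine ⟨K2, hK1.trans hK2, ?_, ?_, hvis2, hnear2, ?_⟩
  · intro z
    rw [hv2, hv1, mem_labels_cons, List.nil_append]
    tauto
  · simp only [edges, optionEdge, Set.insert_subset_iff, Set.union_subset_iff,
      Set.singleton_subset_iff]
    refine ⟨edgeSet_mono hK2 hch rfl, ⟨hK2.graph hadj, edgeSet_mono hK2 hed⟩, hed2⟩
  · intro z hz hxz
    refine hprot2 z (hprot z hz hxz) ?_
    rw [hK1.x_eq z hz.1, hxv1]
    exact hxz

/-- The abscissae `b - 1`, `b`, `b + 2`, `b + 4` allowed for `p` are at distances 4, 3, 1, 1 from `b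
+ 3`. -/
lemma drawLower_nil : DrawLower (nil : OrderedForest W) := by
  intro K a b ξ w p hw hp hxw hxp hξ hnd hfresh
  have hxp' : b - 1 ≤ K.x p ∧ K.x p ≤ b + 4 ∧ K.x p ≠ b + 3 ∧ K.x w ≤ K.x p := by
    rcases hxp with (h | h | h) | ⟨rfl, h⟩ <;> omega
  obtain ⟨K1, hK1, hv1, hx1, hvis1, hadj, hprot⟩ := K.exists_insert (hfresh a (by simp)) (b + 3)
    {p} (by
      rintro q rfl
      exact ⟨hp, one_le_abs_and_le (by omega)⟩)
  refine ⟨K1, hK1, ?_, (hadj p rfl).symm, by simp [edges], hvis1, Or.inl ⟨rfl, hx1⟩, hvis1,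
    Or.inl hx1, ?_⟩
  · intro z
    rw [hv1]
    simp [labels, or_comm]
  · intro z hz hxz
    refine hprot z hz (by omega) ?_
    rintro q rfl
    omega

/-- The path is built bottom-up: the branch of the first child comes before the parent `u`, and `2 *
b + 3 - ξ` swaps `b + 1` and `b + 2`. As `u` is to the left of `b + 3`, it does not cover the last
leaf drawn so far, and it is in the position from which a forest with base `b + 3` can hang. -/
lemma drawLower_cons (hc : DrawLower c) (hs : DrawForest s) : DrawLower (cons a c s) := by
  intro K u b ξ w p hw hp hxw hxp hξ hnd hfresh
  obtain ⟨hu, hnd'⟩ := List.nodup_cons.1 hnd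
  obtain ⟨nd1, nd2, nd3⟩ := nodup_cons_labels hnd'
  rw [mem_labels_cons, not_or] at hu
  obtain ⟨K1, hK1, hv1, hadj1, hed1, hvis1, hx1, hlast1, hnear1, hprot1⟩ :=
    hc K a b (2 * b + 3 - ξ) w p hw hp hxw hxp (by omega) nd1
      fun z hz => hfresh z (List.mem_cons_of_mem _ (mem_labels_cons.2 (Or.inl hz)))
  have hu1 : u ∉ K1.verts := by
    rw [hv1]
    rintro (h | h)
    · exact hfresh u List.mem_cons_self h
    · exact hu.1 h
  obtain ⟨K2, hK2, hv2, hx2, hvis2, hadj2, hprot2⟩ := K1.exists_insert hu1 ξ {a} (by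
      rintro q rfl
      exact ⟨hvis1, one_le_abs_and_le (by omega)⟩)
  have hlast2 : K2.Visible (c.lastLeaf a) := by
    refine hprot2 _ hlast1 (by rcases hnear1 with h | h | h <;> omega) ?_
    rintro q rfl
    rcases hnear1 with h | h | h <;> omega
  have hlx := hK2.x_eq _ hlast1.1
  obtain ⟨K3, hK3, hv3, hed3, hvis3, hnear3, hprot3⟩ := hs K2 (b + 3) u (c.lastLeaf a) hvis2 hlast2
    (by omega) (by rwa [hlx]) nd2 (fun z hz => by
      rw [hv2, hv1]
      rintro (rfl | h | h)
      · exact hu.2 hz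
      · exact hfresh z (List.mem_cons_of_mem _ (mem_labels_cons.2 (Or.inr hz))) h
      · exact nd3 z hz h)
  refine ⟨K3, hK1.trans (hK2.trans hK3), ?_, hK3.graph (hK2.graph hadj1), ?_,
    hprot3 u hvis2 le_rfl, Or.inr ⟨by simp, (hK3.x_eq u hvis2.1).trans hx2⟩, hvis3, hnear3, ?_⟩
  · intro z
    rw [hv3, hv2, hv1, List.mem_cons (b := u), mem_labels_cons]
    clear * -
    tauto
  · simp only [edges, optionEdge, Set.insert_subset_iff, Set.union_subset_iff,
      Set.empty_union]
    exact ⟨hK3.graph (hadj2 a rfl), edgeSet_mono (hK2.trans hK3) hed1, hed3⟩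
  · intro z hz hxz
    have h1 := hK1.x_eq z hz.1
    have hz1 := hprot1 z hz hxz
    have h2 := hK2.x_eq z hz1.1
    refine hprot3 z (hprot2 z hz1 (by omega) ?_) (by omega)
    rintro q rfl
    omega

/-- From `b + 4` the extents are 3 or 2 to `v`, at most 3 to `p`, and exactly 5 to `w` at `b - 1`.
From `b - 2` the leaf would be out of reach, hence the condition on the edge to `w`. -/
lemma drawUpper_leaf : DrawUpper (cons a nil nil) := by
  intro _ K b v w p hv hw hp hxv hxw hxp hnd hfresh
  have hxp' : K.x p = b + 3 ∨ K.x p = b + 5 ∨ K.x p = b + 7 := by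
    rcases hxp with h | h | h <;> omega
  obtain ⟨K1, hK1, hv1, hx1, hvis1, hadj, hprot⟩ := K.exists_insert
    (hfresh a (by simp [labels])) (b + 4)
    {q | q = v ∨ q = p ∨ (q = w ∧ K.x w = b - 1)} (by
      rintro q (rfl | rfl | ⟨rfl, h⟩)
      · exact ⟨hv, one_le_abs_and_le (by omega)⟩
      · exact ⟨hp, one_le_abs_and_le (by omega)⟩
      · exact ⟨hw, one_le_abs_and_le (by omega)⟩)
  refine ⟨K1, hK1, ?_, ?_, hvis1, hx1, ?_, fun h => (hadj w (by simp [h])).symm⟩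
  · intro z
    rw [hv1]
    simp [labels, or_comm]
  · simp only [edges, optionEdge, Set.insert_subset_iff, Set.union_subset_iff,
      Set.empty_subset, and_true, Set.singleton_subset_iff]
    exact ⟨(hadj v (by simp)).symm, (hadj p (by simp)).symm⟩
  · intro z hz hxz
    refine hprot z hz (by omega) ?_
    rintro q (rfl | rfl | ⟨rfl, h⟩) <;> omega

/-- The path to the last leaf is drawn top-down: the only child takes the one of `b + 1`, `b + 2`
that `v` does not occupy. -/
lemma drawUpper_single (hc : DrawUpper c) (hne : c ≠ nil) : DrawUpper (cons a c nil) := by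
  intro _ K b v w p hv hw hp hxv hxw hxp hnd hfresh
  obtain ⟨nd1, -, -⟩ := nodup_cons_labels hnd
  have hxp' : K.x p = b + 3 ∨ K.x p = b + 5 ∨ K.x p = b + 7 := by
    rcases hxp with h | h | h <;> omega
  obtain ⟨K1, hK1, hv1, hx1, hvis1, hadj, hprot⟩ := K.exists_insert
    (hfresh a (by simp [labels])) (2 * b + 3 - K.x v) {v} (by
      rintro q rfl
      exact ⟨hv, one_le_abs_and_le (by omega)⟩)
  have hw1 : K1.Visible w := hprot w hw (by omega) (by rintro q rfl; omega)
  have hp1 : K1.Visible p := hprot p hp (by omega) (by rintro q rfl; omega)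
  have hxw1 := hK1.x_eq w hw.1
  have hxp1 := hK1.x_eq p hp.1
  obtain ⟨K2, hK2, hv2, hed, hvis2, hx2, hprot2, hclose⟩ := hc hne K1 b a w p hvis1 hw1 hp1
    (by omega) (by omega) (by rwa [hxp1]) (List.nodup_cons.1 nd1).2 (fun z hz => by
      rw [hv1]
      rintro (rfl | h)
      · exact (List.nodup_cons.1 nd1).1 hz
      · exact hfresh z (by simp [labels, hz]) h)
  have hl : (cons a c nil).lastLeaf p = c.lastLeaf p := lastLeaf_eq hne a p
  refine ⟨K2, hK1.trans hK2, ?_, ?_, hl ▸ hvis2, hl ▸ hx2, ?_, fun h => ?_⟩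
  · intro z
    rw [hv2, hv1]
    simp only [labels, List.append_nil, List.mem_cons]
    tauto
  · simp only [edges, optionEdge, Set.insert_subset_iff, Set.union_subset_iff,
      Set.empty_subset, and_true, Set.singleton_subset_iff]
    refine ⟨hK2.graph (hadj v rfl).symm, ?_, (edges_none_subset c a _).trans hed⟩
    -- The edge from `p` to the first leaf is among those that the recursive call has drawn.
    cases c with
    | nil => exact absurd rfl hne
    | cons a1 c1 s1 => exact hed (by simp [edges, optionEdge, firstLeaf])
  · intro z hz hxz
    have hxz1 := hK1.x_eq z hz.1
    refine hprot2 z (hprot z hz (by omega) ?_) (by omega)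
    rintro q rfl
    omega
  · rw [hl]
    exact hclose (by omega)

/-- The first branch is off the path to the last leaf, so it goes to the right with base `b + 3`.
This leaves `v` and `w` visible for the remaining ones. -/
lemma drawUpper_cons (hc : DrawTree c) (hs : DrawUpper s) (hne : s ≠ nil) :
    DrawUpper (cons a c s) := by
  intro _ K b v w p hv hw hp hxv hxw hxp hnd hfresh
  obtain ⟨nd1, nd2, nd3⟩ := nodup_cons_labels hnd
  obtain ⟨K1, hK1, hv1, hch, hadj, hed, hvis, hnear, hprot, -⟩ := hc K a [] (b + 3) v p hv hp
    (by omega) (Or.inl hxp) nd1 fun z hz => hfresh z (mem_labels_cons.2 (Or.inl hz))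
  have hxv1 := hK1.x_eq v hv.1
  have hxw1 := hK1.x_eq w hw.1
  obtain ⟨K2, hK2, hv2, hed2, hvis2, hnear2, hprot2, hclose⟩ := hs hne K1 b v w _
    (hprot v hv le_rfl) (hprot w hw (by omega)) hvis
    (by omega) (by omega) hnear nd2 (fun z hz => by
      rw [hv1]
      rintro (h | h)
      · exact hfresh z (mem_labels_cons.2 (Or.inr hz)) h
      · exact nd3 z hz h)
  refine ⟨K2, hK1.trans hK2, ?_, ?_, hvis2, hnear2, ?_, fun h => hclose (by omega)⟩
  · intro z
    rw [hv2, hv1, mem_labels_cons, List.nil_append]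
    tauto
  · simp only [edges, optionEdge, Set.insert_subset_iff, Set.union_subset_iff,
      Set.singleton_subset_iff]
    refine ⟨edgeSet_mono hK2 hch rfl, ⟨hK2.graph hadj, edgeSet_mono hK2 hed⟩, hed2⟩
  · intro z hz hxz
    have hxz1 := hK1.x_eq z hz.1
    exact hprot2 z (hprot z hz (by omega)) (by omega)

/-- Without a trunk, the leaf takes one of `b`, `b + 2`, avoiding the abscissa of `p`. A trunk
occupies `b` and `b + 1`, so the leaf moves to `b + 2` or `b + 4` and is drawn before the trunk,
which then rises to its left and leaves it visible. The edge from `w` at `b - 1` to a leaf at `b +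
4` has extent 5. -/
lemma drawTree_nil : DrawTree (nil : OrderedForest W) := by
  intro K a l b w p hw hp hxw hxp hnd hfresh
  have hxp' : b - 1 ≤ K.x p ∧ K.x p ≤ b + 4 ∧ K.x p ≠ b + 3 ∧ K.x p ≠ b + 1 ∧
      K.x w ≤ K.x p := by
    rcases hxp with (h | h | h) | ⟨rfl, h⟩ <;> omega
  have ha : a ∉ K.verts := hfresh a (by simp)
  cases l with
  | nil =>
    obtain ⟨ξ, hξ, hξp⟩ : ∃ ξ, (ξ = b ∨ ξ = b + 2) ∧ ξ ≠ K.x p := by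
      by_cases h : K.x p = b
      · exact ⟨b + 2, Or.inr rfl, by omega⟩
      · exact ⟨b, Or.inl rfl, by omega⟩
    obtain ⟨K1, hK1, hv1, hx1, hvis1, hadj, hprot⟩ := K.exists_insert ha ξ {w, p} (by
      rintro q (rfl | rfl)
      · exact ⟨hw, one_le_abs_and_le (by omega)⟩
      · exact ⟨hp, one_le_abs_and_le (by omega)⟩)
    refine ⟨K1, hK1, ?_, ?_, (hadj p (by simp)).symm, by simp [edges], hvis1, ?_, ?_,
      fun _ => (hadj w (by simp)).symm⟩
    · intro z
      rw [hv1]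
      simp [labels, or_comm]
    · simpa [chainEdges] using (hadj w (by simp)).symm
    · rcases hξ with rfl | rfl
      · exact Or.inl hx1
      · exact Or.inr (Or.inl hx1)
    · intro z hz hxz
      refine hprot z hz (by omega) ?_
      rintro q (rfl | rfl) <;> omega
  | cons t l =>
    obtain ⟨ξ, hξ, hξp⟩ : ∃ ξ, (ξ = b + 2 ∨ ξ = b + 4) ∧ ξ ≠ K.x p := by
      by_cases h : K.x p = b + 2
      · exact ⟨b + 4, Or.inr rfl, by omega⟩
      · exact ⟨b + 2, Or.inl rfl, by omega⟩
    obtain ⟨K1, hK1, hv1, hx1, hvis1, hadj, hprot⟩ := K.exists_insert ha ξ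
      {q | q = p ∨ (q = w ∧ K.x w = b - 1)} (by
      rintro q (rfl | ⟨rfl, h⟩)
      · exact ⟨hp, one_le_abs_and_le (by omega)⟩
      · exact ⟨hw, one_le_abs_and_le (by omega)⟩)
    have hw1 : K1.Visible w := hprot w hw (by omega) (by rintro q (rfl | ⟨rfl, h⟩) <;> omega)
    have hxw1 := hK1.x_eq w hw.1
    have hnd' := List.nodup_append.1 hnd
    obtain ⟨K2, hK2, hv2, hvis2, hx2, hch2, hadj2, hprot2⟩ := exists_trunk_top (l := l) (u := t)
      (b := b) hw1 hvis1 (by omega) (by omega)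
      (List.nodup_append_comm.1 hnd'.1) (fun z hz => by
        have hz' : z ∈ t :: l := by simpa [or_comm] using hz
        rw [hv1]
        rintro (rfl | h)
        · exact hnd'.2.2 z hz' z (by simp) rfl
        · exact hfresh z (List.mem_append_left _ hz') h)
    refine ⟨K2, hK1.trans hK2, ?_, ?_, hK2.graph (hadj p (by simp)).symm, by simp [edges],
      hprot2 a hvis1 (Or.inr le_rfl), ?_, ?_, fun h => hK2.graph (hadj w (by simp [h])).symm⟩
    · intro z
      rw [hv2, hv1]
      simp only [labels, List.mem_append, List.mem_cons, List.not_mem_nil, or_false]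
      tauto
    · exact Set.insert_subset hadj2 hch2
    · rw [show (nil : OrderedForest W).lastLeaf a = a from rfl, hK2.x_eq a hvis1.1, hx1]
      exact Or.inr hξ
    · intro z hz hxz
      have hxz1 := hK1.x_eq z hz.1
      refine hprot2 z (hprot z hz (by omega) ?_) (by omega)
      rintro q (rfl | ⟨rfl, h⟩) <;> omega

/-- A vertex with a single child only lengthens the trunk. -/
lemma drawTree_single (hc : DrawTree c) : DrawTree (cons a c nil) := by
  intro K u l b w p hw hp hxw hxp hnd hfresh
  have hperm : (l ++ u :: (cons a c nil).labels).Perm ((u :: l) ++ a :: c.labels) := by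
    simp [labels, List.perm_middle]
  obtain ⟨K1, hK1, hv1, hch, hadj, hed, hvis, hnear, hprot, hclose⟩ := hc K a (u :: l) b w p hw hp
    hxw hxp (hperm.nodup_iff.1 hnd) fun z hz => hfresh z (hperm.mem_iff.2 hz)
  obtain ⟨hch1, hch2⟩ := Set.insert_subset_iff.1 hch
  refine ⟨K1, hK1, fun z => by rw [hv1, hperm.mem_iff], hch2, hadj, ?_, hvis, hnear, hprot, hclose⟩
  simp only [edges, optionEdge, Set.insert_subset_iff, Set.union_subset_iff, Set.empty_subset,
    true_and, and_true]
  exact ⟨hch1, hed⟩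

/-- The branch of the first child comes first, with its root at `b + 2`, or at `b + 3` if that is a
leaf. Then the trunk rises on `b` and `b + 1` and ends with `u` at `b + 1`, covering neither `w` nor
the last leaf, which is at `b + 3` or further right. The other children are drawn last, above it. -/
lemma drawTree_branch (hc : DrawLower c) (hs : DrawUpper s) (hne : s ≠ nil) :
    DrawTree (cons a c s) := by
  intro K u l b w p hw hp hxw hxp hnd hfresh
  obtain ⟨ndl, ndu, ndd⟩ := List.nodup_append.1 hnd
  obtain ⟨hu, hnd'⟩ := List.nodup_cons.1 ndu
  obtain ⟨nd1, nd2, nd3⟩ := nodup_cons_labels hnd'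
  rw [mem_labels_cons, not_or] at hu
  have ndd' : ∀ z ∈ l, z ≠ u ∧ z ∉ a :: c.labels ∧ z ∉ s.labels := by
    intro z hz
    refine ⟨ndd z hz u (by simp), fun h => ?_, fun h => ?_⟩
    · exact ndd z hz z (List.mem_cons_of_mem _ (mem_labels_cons.2 (Or.inl h))) rfl
    · exact ndd z hz z (List.mem_cons_of_mem _ (mem_labels_cons.2 (Or.inr h))) rfl
  have fr : ∀ z, z ∈ l ∨ z = u ∨ z ∈ a :: c.labels ∨ z ∈ s.labels → z ∉ K.verts := by
    intro z hz
    apply hfresh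
    rwa [List.mem_append, List.mem_cons, mem_labels_cons]
  obtain ⟨K1, hK1, hv1, hadj1, hed1, hvis1, hx1, hlast1, hnear1, hprot1⟩ :=
    hc K a b (b + 2) w p hw hp hxw hxp (by omega) nd1 fun z hz => fr z (Or.inr (Or.inr (Or.inl hz)))
  have hw1 := hprot1 w hw le_rfl
  have hxw1 := hK1.x_eq w hw.1
  obtain ⟨K2, hK2, hv2, hvis2, hx2, hch2, hadj2, hprot2⟩ := exists_trunk_top (l := l) (u := u)
    (b := b) hw1 hvis1 (by omega) (by omega)
    (by
      rw [List.nodup_append]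
      refine ⟨ndl, List.nodup_singleton _, fun z hz y hy => ?_⟩
      rw [List.mem_singleton] at hy
      subst hy
      exact (ndd' z hz).1)
    (fun z hz => by
      rw [List.mem_append, List.mem_singleton] at hz
      rw [hv1]
      rintro (h | h)
      · exact fr z (hz.imp_right Or.inl) h
      · rcases hz with hz | rfl
        · exact (ndd' z hz).2.1 h
        · exact hu.1 h)
  have hlast2 : K2.Visible (c.lastLeaf a) :=
    hprot2 _ hlast1 (Or.inr (by rcases hnear1 with h | h | h <;> omega))
  have hw2 := hprot2 w hw1 (Or.inl le_rfl)
  have hxw2 := hK2.x_eq w hw1.1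
  obtain ⟨K3, hK3, hv3, hed3, hvis3, hx3, hprot3, hclose⟩ := hs hne K2 b u w (c.lastLeaf a) hvis2
    hw2 hlast2 (by omega) (by omega) (by rwa [hK2.x_eq _ hlast1.1]) nd2 (fun z hz => by
      rw [hv2, hv1, List.mem_append, List.mem_singleton]
      rintro ((h | h) | h | rfl)
      · exact fr z (Or.inr (Or.inr (Or.inr hz))) h
      · exact nd3 z hz h
      · exact (ndd' z h).2.2 hz
      · exact hu.2 hz)
  have hK := hK1.trans (hK2.trans hK3)
  refine ⟨K3, hK, ?_, edgeSet_mono hK3 hch2, hK3.graph (hK2.graph hadj1), ?_, hvis3,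
    Or.inr (Or.inr hx3), ?_, fun h => hclose (by omega)⟩
  · intro z
    rw [hv3, hv2, hv1, List.mem_append, List.mem_append, List.mem_singleton, List.mem_cons (b := u),
      mem_labels_cons]
    clear * -
    tauto
  · simp only [edges, optionEdge, Set.insert_subset_iff, Set.union_subset_iff, Set.empty_union]
    exact ⟨hK3.graph hadj2, edgeSet_mono (hK2.trans hK3) hed1, hed3⟩
  · intro z hz hxz
    have h1 := hK1.x_eq z hz.1
    have hz1 := hprot1 z hz hxz
    have h2 := hK2.x_eq z hz1.1
    exact hprot3 z (hprot2 z hz1 (by omega)) (by omega)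

/-- The four statements call one another, but always for the subtrees `c` of the first root or for
the remaining trees `s`. Edges from `w` to the last leaf drawn in nested calls may be superfluous;
this is harmless, since the graph need only be contained in that of the sketch. -/
theorem draw_all (f : OrderedForest W) :
    DrawTree f ∧ DrawLower f ∧ DrawUpper f ∧ DrawForest f := by
  induction f with
  | nil => exact ⟨drawTree_nil, drawLower_nil, fun h => absurd rfl h, drawForest_nil⟩
  | cons a c s hc hs =>
    refine ⟨?_, drawLower_cons hc.2.1 hs.2.2.2, ?_, drawForest_cons hc.1 hs.2.2.2⟩
    · by_cases h : s = nil
      · subst h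
        exact drawTree_single hc.1
      · exact drawTree_branch hc.2.1 hs.2.2.1 h
    · by_cases h : s = nil
      · subst h
        by_cases h' : c = nil
        · subst h'
          exact drawUpper_leaf
        · exact drawUpper_single hc.2.2.1 h'
      · exact drawUpper_cons hc.1 hs.2.2.1 h

/-- A vertex `r` that is joined to the root of a tree and to its first and last leaf can be drawn
together with the tree and the path through its leaves. -/
theorem exists_of_tree (r c : W) (f : OrderedForest W) (hnd : (r :: c :: f.labels).Nodup) :
    ∃ K : Sketch W, (∀ z ∈ r :: c :: f.labels, z ∈ K.verts) ∧ K.graph.Adj r c ∧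
      K.graph.Adj r (f.firstLeaf c) ∧ K.graph.Adj r (f.lastLeaf c) ∧
      f.edges c none ⊆ K.graph.edgeSet := by
  -- The vertex `r` at `-1` serves both as the parent and as the leaf before the first one. With
  -- base 0 it is at `b - 1`, so the edge to the last leaf is drawn too.
  obtain ⟨K, -, hv, hch, hfirst, hed, -, -, -, hlast⟩ := (draw_all f).1 (single r (-1)) c [] 0 r r
    (visible_single r _) (visible_single r _) (Or.inl rfl) (Or.inr ⟨rfl, rfl⟩)
    (List.nodup_cons.1 hnd).2 (fun z hz => by
      have : z ≠ r := fun h => (List.nodup_cons.1 hnd).1 (h ▸ hz)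
      simpa [single] using this)
  refine ⟨K, fun z hz => (hv z).2 ?_, hch rfl, hfirst, hlast rfl, hed⟩
  simpa [single] using hz

end Sketch


/-! ### Flattening a sketch -/

namespace Sketch

variable {W : Type*} (K : Sketch W)

/-- The points of a sketch, with all heights multiplied by `δ`. -/
noncomputable def point (δ : ℝ) (v : W) : Plane := !₂[(K.x v : ℝ), δ * K.y v]

lemma point_zero (δ : ℝ) (v : W) : K.point δ v 0 = K.x v := by simp [point]

lemma point_one (δ : ℝ) (v : W) : K.point δ v 1 = δ * K.y v := by simp [point]

lemma of_mem_segment {K : Sketch W} {δ : ℝ} {u v : W} (h : K.graph.Adj u v) {p : Plane}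
    (hp : p ∈ segment ℝ (K.point δ u) (K.point δ v)) :
    p 0 ∈ Set.uIcc (K.x u : ℝ) (K.x v) ∧ p 1 = δ * lineHeight K.x K.y u v (p 0) := by
  rw [segment_eq_image] at hp
  obtain ⟨t, ⟨ht0, ht1⟩, rfl⟩ := hp
  have hne : (K.x v : ℝ) - K.x u ≠ 0 := sub_ne_zero.2 (by exact_mod_cast (K.x_ne h).symm)
  simp only [PiLp.add_apply, PiLp.smul_apply, point_zero, point_one, smul_eq_mul]
  constructor
  · have : (1 - t) * (K.x u : ℝ) + t * K.x v ∈ segment ℝ (K.x u : ℝ) (K.x v) := by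
      rw [segment_eq_image]
      exact ⟨t, ⟨ht0, ht1⟩, by simp⟩
    rwa [segment_eq_uIcc] at this
  · simp only [lineHeight]
    have : ((1 - t) * (K.x u : ℝ) + t * K.x v - K.x u) / (K.x v - K.x u) = t := by
      rw [div_eq_iff hne]; ring
    rw [this]
    ring

lemma eq_of_coord_eq {p q : Plane} (h0 : p 0 = q 0) (h1 : p 1 = q 1) : p = q := by
  ext i
  fin_cases i <;> assumption

/-- The drawing obtained from a sketch by scaling the heights. -/
noncomputable def toDrawing {G : SimpleGraph W} (hG : G ≤ K.graph) (hv : ∀ z, z ∈ K.verts)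
    {δ : ℝ} (hδ : 0 < δ) : G.PlanarStraightLineDrawing where
  pos := K.point δ
  pos_injective := by
    intro a b h
    have h0 := congrArg (fun p : Plane => p 0) h
    have h1 := congrArg (fun p : Plane => p 1) h
    simp only [point_zero, point_one] at h0 h1
    exact K.inj (hv a) (hv b) (by exact_mod_cast h0) (mul_left_cancel₀ hδ.ne' h1)
  vertex_of_mem_segment := by
    intro u v w huv hw
    obtain ⟨h0, h1⟩ := of_mem_segment (hG huv) hw
    rw [point_zero] at h0 h1
    rw [point_one] at h1
    exact K.vertex_on_edge (hG huv) (hv w) h0 (mul_left_cancel₀ hδ.ne' h1).symm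
  common_end_of_mem_segments := by
    intro u v z w huv hzw hne p hp hp'
    obtain ⟨h0, h1⟩ := of_mem_segment (hG huv) hp
    obtain ⟨h0', h1'⟩ := of_mem_segment (hG hzw) hp'
    have hh := mul_left_cancel₀ hδ.ne' (h1.symm.trans h1')
    obtain ⟨c, hc, hc', hX⟩ := K.edges_meet (hG huv) (hG hzw) hne (p 0) h0 h0' hh
    refine ⟨c, hc, hc', eq_of_coord_eq (by rw [point_zero, hX]) ?_⟩
    rw [point_one, h1, hX]
    rcases hc with rfl | rfl
    · rw [lineHeight_left]
    · rw [lineHeight_right (K.x_ne (hG huv))]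

lemma one_le_dist_point (δ : ℝ) {u v : W} (h : K.graph.Adj u v) :
    1 ≤ dist (K.point δ u) (K.point δ v) := by
  have h1 := (K.extent h).1
  have h2 := PiLp.dist_apply_le (K.point δ u) (K.point δ v) 0
  rw [point_zero, point_zero, Real.dist_eq] at h2
  refine le_trans ?_ h2
  exact_mod_cast h1

lemma dist_point_le {δ : ℝ} (hδ : 0 < δ) {u v : W} (h : K.graph.Adj u v) :
    dist (K.point δ u) (K.point δ v) ≤ 5 + δ * |K.y u - K.y v| := by
  have h1 : |(K.x u : ℝ) - K.x v| ≤ 5 := by exact_mod_cast (K.extent h).2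
  have h0 := abs_nonneg ((K.x u : ℝ) - K.x v)
  have h3 : 0 ≤ δ * |K.y u - K.y v| := by positivity
  rw [EuclideanSpace.dist_eq, Fin.sum_univ_two, point_zero, point_zero, point_one, point_one,
    Real.dist_eq, Real.dist_eq, ← mul_sub, abs_mul, abs_of_pos hδ]
  apply Real.sqrt_le_iff.2
  constructor
  · linarith
  · nlinarith

/-- With `B` a bound for all height differences, scaling the heights by `ε / B` adds at most `ε` to
the horizontal extent of an edge, while that extent alone keeps each length at least 1. -/
theorem globalEdgeLengthRatio_le {G : SimpleGraph W} (hG : G ≤ K.graph) (hv : ∀ z, z ∈ K.verts) :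
    G.globalEdgeLengthRatio ≤ 5 := by
  refine ENNReal.le_of_forall_pos_le_add fun ε hε _ => ?_
  obtain ⟨B, hB, hBy⟩ : ∃ B : ℝ, 0 < B ∧ ∀ u v : W, |K.y u - K.y v| ≤ B := by
    refine ⟨1 + 2 * ∑ u ∈ K.verts, |K.y u|, ?_, fun u v => ?_⟩
    · have : 0 ≤ ∑ u ∈ K.verts, |K.y u| := Finset.sum_nonneg fun _ _ => abs_nonneg _
      linarith
    · have hu := Finset.single_le_sum (f := fun u => |K.y u|) (fun _ _ => abs_nonneg _) (hv u)
      have hv' := Finset.single_le_sum (f := fun u => |K.y u|) (fun _ _ => abs_nonneg _) (hv v)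
      have := abs_sub (K.y u) (K.y v)
      linarith
  have hε' : (0 : ℝ) < ε := hε
  have hδ : 0 < (ε : ℝ) / B := div_pos hε' hB
  refine (iInf_le _ (K.toDrawing hG hv hδ)).trans (iSup_le fun e => iSup_le fun e' => ?_)
  have h1 : EDist.edist (K.point (ε / B) e.fst) (K.point (ε / B) e.snd) ≤ 5 + ε := by
    rw [edist_dist]
    have := K.dist_point_le hδ (hG e.adj)
    have h2 : (ε : ℝ) / B * |K.y e.fst - K.y e.snd| ≤ ε := by
      rw [div_mul_eq_mul_div, div_le_iff₀ hB]
      exact mul_le_mul_of_nonneg_left (hBy _ _) hε'.le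
    refine (ENNReal.ofReal_le_ofReal (this.trans (add_le_add_right h2 _))).trans ?_
    rw [ENNReal.ofReal_add (by norm_num) hε'.le, ENNReal.ofReal_coe_nnreal]
    simp
  have h2 : 1 ≤ EDist.edist (K.point (ε / B) e'.fst) (K.point (ε / B) e'.snd) := by
    rw [edist_dist, ← ENNReal.ofReal_one]
    exact ENNReal.ofReal_le_ofReal (K.one_le_dist_point _ (hG e'.adj))
  exact (ENNReal.div_le_div h1 h2).trans (by simp)

end Sketch


/-! ### Faces of an embedded Halin graph -/

lemma Equiv.Perm.SameCycle.apply_eq_of_invariant {α β : Type*} {σ : Equiv.Perm α} {χ : α → β}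
    (h : ∀ a, χ (σ a) = χ a) {a b : α} (hab : σ.SameCycle a b) : χ a = χ b := by
  obtain ⟨i, rfl⟩ := hab
  induction i with
  | zero => rfl
  | succ n ih => rw [add_comm, zpow_add, zpow_one, Equiv.Perm.mul_apply, h, ih]
  | pred n ih =>
    rw [ih, ← h ((σ ^ (-(n : ℤ) - 1)) a), ← Equiv.Perm.mul_apply, ← zpow_one_add]
    congr 3
    ring

namespace SimpleGraph

variable {V : Type*} {H : SimpleGraph V}

namespace RotationSystem

variable (R : H.RotationSystem) (f : R.Face)

lemma facePerm_apply (d : H.Dart) : R.facePerm d = R.next d.symm := rfl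

lemma facePerm_fst (d : H.Dart) : (R.facePerm d).fst = d.snd := R.fst_next d.symm

lemma faceOf_facePerm (d : H.Dart) : R.faceOf (R.facePerm d) = R.faceOf d :=
  Quotient.sound (s := Equiv.Perm.SameCycle.setoid R.facePerm) ⟨-1, by simp⟩

/-- Face tracing that arrives along `d.symm` leaves along `R.next d`: the corner between two
successive edges lies in one face. -/
lemma faceOf_next (d : H.Dart) : R.faceOf (R.next d) = R.faceOf d.symm := by
  rw [← R.faceOf_facePerm d.symm, facePerm_apply, Dart.symm_symm]

variable {R f}

lemma mem_faceEdges {d : H.Dart} :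
    d.edge ∈ R.faceEdges f ↔ R.faceOf d = f ∨ R.faceOf d.symm = f := by
  constructor
  · rintro ⟨d', hd', he⟩
    rcases (dart_edge_eq_iff _ _).1 he with rfl | rfl
    · exact Or.inl hd'
    · exact Or.inr hd'
  · rintro (h | h)
    · exact ⟨d, h, rfl⟩
    · exact ⟨d.symm, h, d.edge_symm⟩

variable (R f) in
/-- The graph that remains when the edges incident to the face `f` are removed. -/
abbrev skeleton : SimpleGraph V := H.deleteEdges (R.faceEdges f)

lemma skeleton_adj (d : H.Dart) :
    (R.skeleton f).Adj d.fst d.snd ↔ R.faceOf d ≠ f ∧ R.faceOf d.symm ≠ f := by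
  rw [deleteEdges_adj, ← not_or, ← mem_faceEdges]
  exact and_iff_right d.adj

lemma isTree_side {t : H.Dart} (hT : (R.skeleton f).IsTree)
    (ht : (R.skeleton f).Adj t.fst t.snd) :
    ¬ ((R.skeleton f).deleteEdges {t.edge}).Reachable t.snd t.fst := fun h =>
  isAcyclic_iff_forall_isBridge.1 hT.isAcyclic (e := s(t.fst, t.snd)) ht h.symm

/-- Both ends of a tree edge other than the edge of `t` lie on the same side of `t`. -/
lemma side_iff {t d : H.Dart} (hd : (R.skeleton f).Adj d.fst d.snd) (h1 : d ≠ t) (h2 : d ≠ t.symm)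
    (v : V) : ((R.skeleton f).deleteEdges {t.edge}).Reachable v d.fst ↔
      ((R.skeleton f).deleteEdges {t.edge}).Reachable v d.snd := by
  have : ((R.skeleton f).deleteEdges {t.edge}).Adj d.fst d.snd := by
    rw [deleteEdges_adj]
    refine ⟨hd, fun h => ?_⟩
    rcases (dart_edge_eq_iff d t).1 h with h | h
    · exact h1 h
    · exact h2 h
  exact ⟨fun h => h.trans this.reachable, fun h => h.trans this.symm.reachable⟩

/-- A function on the darts that is constant along faces, and takes the same value on both sides
of every edge outside a spanning tree, is constant. -/
theorem eq_of_invariant [Finite V] (hc : H.Connected) (hT : (R.skeleton f).IsTree)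
    (χ : H.Dart → ℤ) (h1 : ∀ d, χ (R.facePerm d) = χ d)
    (h2 : ∀ d : H.Dart, ¬ (R.skeleton f).Adj d.fst d.snd → χ d.symm = χ d) (d d' : H.Dart) :
    χ d = χ d' := by
  classical
  have := Fintype.ofFinite V
  have hnext : ∀ d, χ (R.next d) = χ d.symm := fun d => by
    rw [← h1 d.symm, facePerm_apply, Dart.symm_symm]
  have hsymm : ∀ t : H.Dart, χ t.symm = χ t := by
    intro t
    by_cases ht : (R.skeleton f).Adj t.fst t.snd
    swap
    · exact h2 t ht
    let B : V → Prop := fun v => ((R.skeleton f).deleteEdges {t.edge}).Reachable t.snd v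
    have hBf : ¬ B t.fst := isTree_side hT ht
    have hBs : B t.snd := Reachable.refl _
    let D : Finset H.Dart := Finset.univ.filter fun d => B d.fst
    -- The jumps of `χ` over all darts that start on one side of `t` sum to zero, because `R.next`
    -- permutes these darts and `χ (R.next d) = χ d.symm`. Darts inside the side cancel in pairs and
    -- edges outside the tree do not jump, which leaves only the jump across `t`.
    have hsum : ∑ d ∈ D, (χ d.symm - χ d) = 0 := by
      rw [Finset.sum_sub_distrib, sub_eq_zero]
      calc ∑ d ∈ D, χ d.symm = ∑ d ∈ D, χ (R.next d) :=
            Finset.sum_congr rfl fun d _ => (hnext d).symm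
        _ = ∑ d ∈ D, χ d := by
            refine Finset.sum_equiv R.next (fun d => ?_) fun d _ => rfl
            simp only [D, Finset.mem_filter, Finset.mem_univ, true_and, R.fst_next]
    rw [← Finset.sum_filter_add_sum_filter_not D (fun d => B d.snd)] at hsum
    have hin : ∑ d ∈ D with B d.snd, (χ d.symm - χ d) = 0 := by
      refine Finset.sum_involution (fun d _ => d.symm) (fun d _ => ?_) (fun d _ _ => d.symm_ne)
        (fun d hd => ?_) (fun d _ => d.symm_symm)
      · rw [Dart.symm_symm]; ring
      · simp only [D, Finset.mem_filter, Finset.mem_univ, true_and] at hd ⊢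
        exact ⟨hd.2, hd.1⟩
    have hout : ∑ d ∈ D with ¬ B d.snd, (χ d.symm - χ d) = χ t - χ t.symm := by
      rw [Finset.sum_eq_single t.symm]
      · rw [Dart.symm_symm]
      · intro d hd hne
        simp only [D, Finset.mem_filter, Finset.mem_univ, true_and] at hd
        by_cases hd' : (R.skeleton f).Adj d.fst d.snd
        · exfalso
          by_cases hdt : d = t
          · subst hdt
            exact hBf hd.1
          · exact hd.2 ((side_iff hd' hdt hne _).1 hd.1)
        · rw [h2 d hd', sub_self]
      · intro hn
        exact absurd (by simpa [D] using ⟨hBs, hBf⟩) hn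
    rw [hin, hout] at hsum
    omega
  have hsame : ∀ a b : H.Dart, a.fst = b.fst → χ a = χ b := fun a b h =>
    (R.sameCycle_of_fst_eq a b h).apply_eq_of_invariant fun a => by rw [hnext, hsymm]
  have key : ∀ {u v : V}, H.Walk u v → ∀ a b : H.Dart, a.fst = u → b.fst = v → χ a = χ b := by
    intro u v p
    induction p with
    | nil => exact fun a b ha hb => hsame a b (ha.trans hb.symm)
    | cons h p ih =>
      intro a b ha hb
      rw [hsame a ⟨(_, _), h⟩ ha, ← hsymm]
      exact ih _ b rfl hb
  obtain ⟨p⟩ := hc.preconnected d.fst d'.fst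
  exact key p d d' rfl rfl

/-- At a vertex that is not on the outer face all edges belong to the tree. -/
lemma skeleton_adj_of_not_mem_outer {d : H.Dart} (h : d.fst ∉ R.faceVertices f) :
    (R.skeleton f).Adj d.fst d.snd := by
  rw [skeleton_adj]
  refine ⟨fun h' => h ⟨d, h', rfl⟩, fun h' => h ⟨R.next d, ?_, R.fst_next d⟩⟩
  rw [R.faceOf_next, h']

end RotationSystem

namespace IsEmbeddedHalin

open RotationSystem

variable {R : H.RotationSystem} {f : R.Face} (hH : H.IsEmbeddedHalin R f)

include hH

/-- The edges outside the tree are exactly those of the outer face, and the tree has one edge less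
than vertices; the rest is Euler's formula. -/
lemma card_face : Nat.card R.Face = (R.faceEdges f).ncard + 1 := by
  have := hH.finite
  have h1 := hH.planar.2
  have h2 : (R.skeleton f).edgeSet.ncard + 1 = Nat.card V := by
    rw [← Nat.card_coe_set_eq]
    exact (isTree_iff_connected_and_card.1 hH.isTree).2
  have h3 : H.edgeSet.ncard = (R.skeleton f).edgeSet.ncard + (R.faceEdges f).ncard := by
    have hsub : R.faceEdges f ⊆ H.edgeSet := by
      rintro e ⟨d, -, rfl⟩
      exact d.edge_mem
    rw [edgeSet_deleteEdges, Set.ncard_sdiff_add_ncard_of_subset hsub]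
  rw [Nat.card_coe_set_eq] at h1
  omega

/-- The inner darts: those whose reversal lies on the outer face. Each face other than the outer
one contains exactly one of them. -/
lemma inner_facts :
    (∀ d : H.Dart, R.faceOf d = f → R.faceOf d.symm ≠ f) ∧
    (∀ d d' : H.Dart, R.faceOf d.symm = f → R.faceOf d'.symm = f →
      R.faceOf d = R.faceOf d' → d = d') ∧
    ∀ g, g ≠ f → ∃ d : H.Dart, R.faceOf d.symm = f ∧ R.faceOf d = g := by
  classical
  have := hH.finite
  have := Fintype.ofFinite V
  let I : Set H.Dart := {d | R.faceOf d.symm = f ∧ R.faceOf d ≠ f}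
  -- If `g` contained no such dart, its indicator function would vanish on both sides of every edge
  -- outside the tree, and so be constant.
  have hsurj : ∀ g, g ≠ f → ∃ d ∈ I, R.faceOf d = g := by
    intro g hg
    by_contra! hno
    obtain ⟨d₁, hd₁⟩ := Quotient.exists_rep g
    obtain ⟨d₂, hd₂⟩ := Quotient.exists_rep f
    have hd₁ : R.faceOf d₁ = g := hd₁
    have hd₂ : R.faceOf d₂ = f := hd₂
    have hz : ∀ d : H.Dart, ¬ (R.skeleton f).Adj d.fst d.snd → R.faceOf d ≠ g := by
      intro d hd he
      rw [skeleton_adj] at hd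
      have hdf : R.faceOf d ≠ f := he ▸ hg
      exact hno d ⟨by tauto, hdf⟩ he
    have := R.eq_of_invariant hH.planar.1 hH.isTree (fun d => if R.faceOf d = g then 1 else 0)
      (fun d => by rw [R.faceOf_facePerm]) (fun d hd => by
        rw [if_neg (hz d hd), if_neg (hz d.symm fun h => hd h.symm)]) d₁ d₂
    rw [if_pos hd₁, hd₂, if_neg hg.symm] at this
    omega
  -- `I` injects into the outer edges and maps onto the faces other than `f`. By Euler's formula
  -- these two sets are equally large, so both maps are bijective.
  have hI : I.ncard = (R.faceEdges f).ncard ∧ Set.InjOn R.faceOf I := by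
    have hmap : ∀ d ∈ I, d.edge ∈ R.faceEdges f := fun d hd => mem_faceEdges.2 (Or.inr hd.1)
    have hinj : Set.InjOn Dart.edge I := by
      intro d hd d' hd' he
      rcases (dart_edge_eq_iff _ _).1 he with h | h
      · exact h
      · subst h
        have := hd.1
        rw [Dart.symm_symm] at this
        exact absurd this hd'.2
    have hle : I.ncard ≤ (R.faceEdges f).ncard := Set.ncard_le_ncard_of_injOn _ hmap hinj
    have himg : R.faceOf '' I = {f}ᶜ := by
      ext g
      constructor
      · rintro ⟨d, hd, rfl⟩
        exact hd.2
      · intro hg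
        obtain ⟨d, hd, h⟩ := hsurj g hg
        exact ⟨d, hd, h⟩
    have hcard : ({f}ᶜ : Set R.Face).ncard = (R.faceEdges f).ncard := by
      have := Set.ncard_add_ncard_compl ({f} : Set R.Face)
      rw [Set.ncard_singleton, hH.card_face] at this
      omega
    have hge : (R.faceOf '' I).ncard ≤ I.ncard := Set.ncard_image_le
    rw [himg, hcard] at hge
    have heq := le_antisymm hle hge
    refine ⟨heq, Set.injOn_of_ncard_image_eq ?_⟩
    rw [himg, hcard, heq]
  -- Each outer edge comes from a dart of `I`, so none has the outer face on both sides.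
  have hone : ∀ d : H.Dart, R.faceOf d = f → R.faceOf d.symm ≠ f := by
    have hmap : ∀ d ∈ I, d.edge ∈ R.faceEdges f := fun d hd => mem_faceEdges.2 (Or.inr hd.1)
    have hinj : Set.InjOn Dart.edge I := by
      intro d hd d' hd' he
      rcases (dart_edge_eq_iff _ _).1 he with h | h
      · exact h
      · subst h
        have := hd.1
        rw [Dart.symm_symm] at this
        exact absurd this hd'.2
    have himg : Dart.edge '' I = R.faceEdges f := by
      refine Set.eq_of_subset_of_ncard_le ?_ ?_
      · rintro _ ⟨d, hd, rfl⟩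
        exact hmap d hd
      · rw [hinj.ncard_image, hI.1]
    intro d hd hd'
    have : d.edge ∈ Dart.edge '' I := by
      rw [himg]
      exact mem_faceEdges.2 (Or.inl hd)
    obtain ⟨d', hd'I, he⟩ := this
    rcases (dart_edge_eq_iff _ _).1 he with h | h
    · subst h
      exact hd'I.2 hd
    · subst h
      exact hd'I.2 hd'
  have hmem : ∀ d : H.Dart, R.faceOf d.symm = f → d ∈ I := fun d hd =>
    ⟨hd, fun h => hone d h hd⟩
  refine ⟨hone, fun d d' hd hd' he => hI.2 (hmem d hd) (hmem d' hd') he, fun g hg => ?_⟩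
  obtain ⟨d, hd, h⟩ := hsurj g hg
  exact ⟨d, hd.1, h⟩

lemma faceOf_symm_ne {d : H.Dart} (h : R.faceOf d = f) : R.faceOf d.symm ≠ f :=
  hH.inner_facts.1 d h

lemma faceOf_ne {d : H.Dart} (h : R.faceOf d.symm = f) : R.faceOf d ≠ f := fun h' =>
  hH.inner_facts.1 d h' h

lemma inner_unique {d d' : H.Dart} (h : R.faceOf d.symm = f) (h' : R.faceOf d'.symm = f)
    (he : R.faceOf d = R.faceOf d') : d = d' :=
  hH.inner_facts.2.1 d d' h h' he

lemma exists_inner {g : R.Face} (hg : g ≠ f) :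
    ∃ d : H.Dart, R.faceOf d.symm = f ∧ R.faceOf d = g :=
  hH.inner_facts.2.2 g hg

/-- After a dart on the outer face there follows a tree edge. -/
lemma skeleton_adj_next {d : H.Dart} (hd : R.faceOf d = f) :
    (R.skeleton f).Adj (R.next d).fst (R.next d).snd := by
  rw [skeleton_adj, R.faceOf_next]
  refine ⟨hH.faceOf_symm_ne hd, fun h => ?_⟩
  have h' : R.faceOf d.symm.symm = f := by rwa [Dart.symm_symm]
  have := hH.inner_unique h h' (R.faceOf_next d)
  have h1 := R.fst_next d
  rw [this] at h1
  exact d.fst_ne_snd h1.symm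

/-- The edge of the outer face whose other side is the face of `t`, and the one whose other side
is the face of `t.symm`, are the only ones that join the two sides of the tree edge `t`. -/
lemma faceOf_of_crossing {t d : H.Dart} (hd : R.faceOf d.symm = f) {v : V}
    (hcross : ¬ (((R.skeleton f).deleteEdges {t.edge}).Reachable v d.fst ↔
      ((R.skeleton f).deleteEdges {t.edge}).Reachable v d.snd)) :
    R.faceOf d = R.faceOf t ∨ R.faceOf d = R.faceOf t.symm := by
  classical
  have := hH.finite
  have := Fintype.ofFinite V
  by_contra! hne
  let P := fun w => ((R.skeleton f).deleteEdges {t.edge}).Reachable v w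
  have hface : ∀ k, R.faceOf ((R.facePerm ^ k) d) = R.faceOf d := by
    intro k
    induction k with
    | zero => rfl
    | succ k ih => rw [pow_succ', Equiv.Perm.mul_apply, R.faceOf_facePerm, ih]
  -- Until the face walk returns to `d`, it uses only tree darts, and none of them is `t` or its
  -- reversal; hence it never changes sides.
  have hside : ∀ k, (∀ j, 1 ≤ j → j ≤ k → (R.facePerm ^ j) d ≠ d) →
      (P ((R.facePerm ^ (k + 1)) d).fst ↔ P d.snd) := by
    intro k
    induction k with
    | zero =>
      intro _
      rw [zero_add, pow_one, R.facePerm_fst]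
    | succ k ih =>
      intro hk
      rw [← ih fun j h1 h2 => hk j h1 (by omega), pow_succ' _ (k + 1), Equiv.Perm.mul_apply,
        R.facePerm_fst]
      refine (side_iff ((skeleton_adj _).2 ⟨?_, fun h => ?_⟩) (fun h => ?_) (fun h => ?_) v).symm
      · rw [hface]
        exact hH.faceOf_ne hd
      · exact hk (k + 1) (by omega) le_rfl (hH.inner_unique h hd (hface _))
      · exact hne.1 (by rw [← h, hface])
      · exact hne.2 (by rw [← h, hface])
  have hex : ∃ n, 1 ≤ n ∧ (R.facePerm ^ n) d = d :=
    ⟨orderOf R.facePerm, orderOf_pos _, by rw [pow_orderOf_eq_one]; rfl⟩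
  obtain ⟨hn1, hn2⟩ := Nat.find_spec hex
  have := hside (Nat.find hex - 1) fun j h1 h2 h3 => by
    have := Nat.find_min' hex ⟨h1, h3⟩
    omega
  rw [Nat.sub_add_cancel hn1, hn2] at this
  exact hcross this

/-- A vertex of the outer face is a leaf of the tree. -/
lemma ncard_eq_one_of_mem_outer {d : H.Dart} (hd : R.faceOf d = f) :
    ((R.skeleton f).neighborSet d.fst).ncard = 1 := by
  classical
  have := hH.finite
  have := Fintype.ofFinite V
  by_contra hcard
  have h3 := hH.three_le_degree d.fst hcard
  set v := d.fst with hv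
  set t := R.next d with ht
  have htv : t.fst = v := R.fst_next d
  have hadj : (R.skeleton f).Adj t.fst t.snd := hH.skeleton_adj_next hd
  let B : V → Prop := fun w => ((R.skeleton f).deleteEdges {t.edge}).Reachable t.snd w
  have hBt : B t.snd := Reachable.refl _
  have hBv : ¬ B v := htv ▸ isTree_side hH.isTree hadj
  obtain ⟨d₁, hd₁, hd₁'⟩ := hH.exists_inner ((skeleton_adj t).1 hadj).2
  -- Only the edges of `t`, `d` and `d₁` can join `B` to its complement, and the first two are
  -- incident to `v`. Taking for `w` the end of `d₁` outside `B` if `d₁` crosses, the pair `v`, `w`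
  -- cuts `B` off.
  obtain ⟨w, hw, hBw⟩ : ∃ w, ((B d₁.fst ∧ ¬ B d₁.snd → w = d₁.snd) ∧
      (B d₁.snd ∧ ¬ B d₁.fst → w = d₁.fst)) ∧ ¬ B w := by
    by_cases h1 : B d₁.fst
    · by_cases h2 : B d₁.snd
      · exact ⟨v, by tauto, hBv⟩
      · exact ⟨d₁.snd, by tauto, h2⟩
    · exact ⟨d₁.fst, by tauto, h1⟩
  -- Tree degree at least 3 leaves a neighbour of `v` other than `t.snd` and `w`; it is on the side
  -- of `v`, so something remains outside `B`.
  obtain ⟨z, hzv, hzw, hzB⟩ : ∃ z, z ≠ v ∧ z ≠ w ∧ ¬ B z := by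
    have : 2 < ((R.skeleton f).neighborSet v).ncard := h3
    have hlt : (({t.snd, w} : Finset V) : Set V).ncard <
        ((R.skeleton f).neighborSet v).ncard := by
      rw [Set.ncard_coe_finset]
      exact lt_of_le_of_lt Finset.card_le_two this
    obtain ⟨z, hz, hz'⟩ := Set.exists_mem_notMem_of_ncard_lt_ncard hlt
    simp only [Finset.coe_insert, Finset.coe_singleton, Set.mem_insert_iff,
      Set.mem_singleton_iff, not_or] at hz'
    have hz : (R.skeleton f).Adj v z := hz
    refine ⟨z, hz.ne', hz'.2, fun hB => hBv ?_⟩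
    let dz : H.Dart := ⟨(v, z), (deleteEdges_adj.1 hz).1⟩
    refine (side_iff (d := dz) hz (fun h => hz'.1 ?_) (fun h => ?_) t.snd).2 hB
    · rw [← h]
    · have : v = t.snd := congrArg (fun d : H.Dart => d.fst) h
      exact hBv (this ▸ hBt)
  have hconn := hH.threeConnected.2 {v, w} (lt_of_le_of_lt Finset.card_le_two (by norm_num))
  have htS : t.snd ∉ ({v, w} : Finset V) := by
    simp only [Finset.mem_insert, Finset.mem_singleton, not_or]
    exact ⟨fun h => hBv (h ▸ hBt), fun h => hBw (h ▸ hBt)⟩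
  have hzS : z ∉ ({v, w} : Finset V) := by simp [hzv, hzw]
  obtain ⟨p⟩ := hconn.preconnected ⟨t.snd, htS⟩ ⟨z, hzS⟩
  obtain ⟨e, -, he1, he2⟩ := p.exists_boundary_dart {x | B x.1} hBt hzB
  obtain ⟨⟨⟨x, hxS⟩, ⟨y, hyS⟩⟩, hxy⟩ := e
  have he1 : B x := he1
  have he2 : ¬ B y := he2
  have hxy : H.Adj x y := hxy
  have hyS' : y ≠ v ∧ y ≠ w := by
    have : y ∉ ({v, w} : Finset V) := hyS
    simpa [not_or] using this
  have hcross : ∀ d' : H.Dart, R.faceOf d'.symm = f → s(d'.fst, d'.snd) = s(x, y) → False := by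
    intro d' hd' hs
    have hend : (d'.fst = x ∧ d'.snd = y) ∨ (d'.fst = y ∧ d'.snd = x) := by
      exact Sym2.eq_iff.1 hs
    have hc : ¬ (B d'.fst ↔ B d'.snd) := by
      rcases hend with ⟨h1, h2⟩ | ⟨h1, h2⟩ <;> rw [h1, h2] <;> tauto
    rcases hH.faceOf_of_crossing hd' hc with h | h
    · have : d' = d.symm := hH.inner_unique hd' (by rwa [Dart.symm_symm])
        (h.trans (R.faceOf_next d))
      have hsnd : d'.snd = v := by rw [this, hv]; rfl
      rcases hend with ⟨h1, h2⟩ | ⟨h1, h2⟩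
      · exact hyS'.1 (h2.symm.trans hsnd)
      · exact hBv (by rw [← hsnd, h2]; exact he1)
    · have : d' = d₁ := hH.inner_unique hd' hd₁ (h.trans hd₁'.symm)
      subst this
      rcases hend with ⟨h1, h2⟩ | ⟨h1, h2⟩
      · exact hyS'.2 (h2 ▸ (hw.1 ⟨by rwa [h1], by rwa [h2]⟩).symm)
      · exact hyS'.2 (h1 ▸ (hw.2 ⟨by rwa [h2], by rwa [h1]⟩).symm)
  let e : H.Dart := ⟨(x, y), hxy⟩
  by_cases hT : (R.skeleton f).Adj x y
  · have h1 : e ≠ t := fun h => hBv (by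
      have : x = t.fst := congrArg (fun d : H.Dart => d.fst) h
      rwa [← htv, ← this])
    have h2 : e ≠ t.symm := fun h => hyS'.1 (by
      have : y = t.fst := congrArg (fun d : H.Dart => d.snd) h
      rw [this, htv])
    exact he2 ((side_iff (d := e) hT h1 h2 t.snd).1 he1)
  · have := (skeleton_adj (R := R) (f := f) e).not.1 hT
    rw [not_and_or, not_not, not_not] at this
    rcases this with h | h
    · exact hcross e.symm (by rwa [Dart.symm_symm]) Sym2.eq_swap
    · exact hcross e h rfl

/-- The tree edge at a vertex of the outer face is unique. -/
lemma tree_dart_unique {d t t' : H.Dart} (hd : R.faceOf d = f) (h1 : t.fst = d.fst)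
    (h2 : t'.fst = d.fst) (ht : (R.skeleton f).Adj t.fst t.snd)
    (ht' : (R.skeleton f).Adj t'.fst t'.snd) : t = t' := by
  obtain ⟨a, ha⟩ := Set.ncard_eq_one.1 (hH.ncard_eq_one_of_mem_outer hd)
  have e1 : t.snd = a := by
    have : t.snd ∈ (R.skeleton f).neighborSet d.fst := by rw [← h1]; exact ht
    rwa [ha] at this
  have e2 : t'.snd = a := by
    have : t'.snd ∈ (R.skeleton f).neighborSet d.fst := by rw [← h2]; exact ht'
    rwa [ha] at this
  exact Dart.ext _ _ (Prod.ext (h1.trans h2.symm) (e1.trans e2.symm))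

/-- At a vertex of the outer face, the tree edge is followed by an edge whose reversal is on the
outer face. -/
lemma faceOf_next_symm {d t : H.Dart} (hd : R.faceOf d = f) (h1 : t.fst = d.fst)
    (ht : (R.skeleton f).Adj t.fst t.snd) : R.faceOf (R.next t).symm = f := by
  by_contra hne
  have hT : (R.skeleton f).Adj (R.next t).fst (R.next t).snd := by
    rw [skeleton_adj, R.faceOf_next]
    exact ⟨((skeleton_adj t).1 ht).2, hne⟩
  -- Then `t` would be the only dart at its vertex, although `d` is one on the outer face.
  have hfix : R.next t = t :=
    hH.tree_dart_unique hd (by rw [R.fst_next, h1]) h1 hT ht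
  have := (R.sameCycle_of_fst_eq t d h1).apply_eq_of_invariant (χ := fun x => x = t) (fun a => by
    rw [eq_iff_iff]
    constructor
    · intro h
      exact R.next.injective (h.trans hfix.symm)
    · rintro rfl
      exact hfix)
  have hdt : d = t := this ▸ rfl
  subst hdt
  exact ((skeleton_adj d).1 ht).1 hd

end IsEmbeddedHalin

end SimpleGraph


/-! ### Ordered trees from walks, and lists from cyclic orders -/

namespace OrderedForest

variable {W : Type*}

lemma labels_cons_nil (a : W) (c : OrderedForest W) : (cons a c nil).labels = a :: c.labels := by
  simp [labels]

lemma edge_firstLeaf_mem {f : OrderedForest W} (h : f ≠ nil) (v p d : W) :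
    s(p, f.firstLeaf d) ∈ f.edges v (some p) := by
  cases f with
  | nil => exact absurd rfl h
  | cons w c s => simp [edges, optionEdge, firstLeaf]

end OrderedForest

open OrderedForest in
/-- A tree that consists of the path followed by the walk `p` and of the forest `c` below its
end. -/
lemma exists_tree_of_walk {W : Type*} {G : SimpleGraph W} {u z : W} (p : G.Walk u z)
    (hp : u ≠ z) (c : OrderedForest W) : ∃ (a : W) (t : OrderedForest W),
      a :: t.labels = p.support.tail ++ c.labels ∧
      (∀ e ∈ p.edges, e = s(u, a) ∨ e ∈ t.edges a none) ∧
      c.edges z none ⊆ t.edges a none ∧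
      t.firstLeaf a = c.firstLeaf z ∧ t.lastLeaf a = c.lastLeaf z := by
  have key : ∀ {u z : W} (p : G.Walk u z), ¬ p.Nil → ∃ (a : W) (t : OrderedForest W),
      a :: t.labels = p.support.tail ++ c.labels ∧
      (∀ e ∈ p.edges, e = s(u, a) ∨ e ∈ t.edges a none) ∧
      c.edges z none ⊆ t.edges a none ∧
      t.firstLeaf a = c.firstLeaf z ∧ t.lastLeaf a = c.lastLeaf z := by
    intro u z p
    induction p with
    | nil => exact fun h => absurd SimpleGraph.Walk.Nil.nil h
    | @cons u v z h p ih =>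
      intro _
      cases p with
      | nil => exact ⟨v, c, by simp, by simp, subset_rfl, rfl, rfl⟩
      | cons h' p =>
        obtain ⟨a, t, h1, h2, h3, h4, h5⟩ := ih SimpleGraph.Walk.not_nil_cons
        have hed : (cons a t nil).edges v none = insert s(v, a) (t.edges a none) := by
          simp [edges, optionEdge]
        refine ⟨v, cons a t nil, ?_, ?_, ?_, h4, h5⟩
        · rw [labels_cons_nil, h1]
          simp
        · intro e he
          rw [SimpleGraph.Walk.edges_cons, List.mem_cons] at he
          rw [hed]
          rcases he with rfl | he
          · exact Or.inl rfl
          · exact Or.inr (h2 e he)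
        · rw [hed]
          exact h3.trans (Set.subset_insert _ _)
  exact key p fun h => hp h.eq

/-- The elements of the cycle of a permutation through `x`, apart from `x`, in their order. -/
lemma Equiv.Perm.exists_chain_of_ne {α : Type*} [Finite α] (σ : Equiv.Perm α) {x : α}
    (hx : σ x ≠ x) : ∃ (a : α) (l : List α), a = σ x ∧
      (a :: l).IsChain (fun y z => z = σ y) ∧ (a :: l).Nodup ∧
      (∀ y, y ∈ a :: l ↔ σ.SameCycle x y ∧ y ≠ x) ∧ σ ((a :: l).getLast (by simp)) = x := by
  classical
  have := Fintype.ofFinite α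
  have hxs : x ∈ σ.support := Equiv.Perm.mem_support.2 hx
  have hlen := Equiv.Perm.two_le_length_toList_iff_mem_support.2 hxs
  have hchain : (σ.toList x).IsChain (fun y z => z = σ y) := by
    rw [List.isChain_iff_getElem]
    intro i hi
    rw [Equiv.Perm.getElem_toList, Equiv.Perm.getElem_toList, pow_succ', Equiv.Perm.mul_apply]
  have hnd := Equiv.Perm.nodup_toList σ x
  have hmem : ∀ y, y ∈ σ.toList x ↔ σ.SameCycle x y := fun y => by
    rw [Equiv.Perm.mem_toList_iff, and_iff_left hxs]
  have h0 : ∀ h : 0 < (σ.toList x).length, (σ.toList x)[0] = x := fun _ =>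
    Equiv.Perm.toList_getElem_zero σ x hxs
  have hlast : ∀ h, σ ((σ.toList x).getLast h) = x := by
    intro h
    rw [List.getLast_eq_getElem, Equiv.Perm.getElem_toList, ← Equiv.Perm.mul_apply, ← pow_succ',
      Nat.sub_add_cancel (by omega), Equiv.Perm.length_toList,
      ← Equiv.Perm.pow_mod_card_support_cycleOf_self_apply, Nat.mod_self]
    rfl
  revert hlen hchain hnd hmem h0 hlast
  generalize σ.toList x = L
  intro hlen hchain hnd hmem h0 hlast
  match L, hlen with
  | y :: a :: l, _ =>
    have h0 : y = x := h0 (by simp)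
    subst h0
    refine ⟨a, l, (List.isChain_cons_cons.1 hchain).1, (List.isChain_cons_cons.1 hchain).2,
      (List.nodup_cons.1 hnd).2, fun z => ?_, ?_⟩
    · rw [← hmem, List.mem_cons (b := y)]
      constructor
      · intro hz
        refine ⟨Or.inr hz, ?_⟩
        rintro rfl
        exact (List.nodup_cons.1 hnd).1 hz
      · rintro ⟨h | h, h'⟩
        · exact absurd h h'
        · exact h
    · have := hlast (by simp)
      rwa [List.getLast_cons (by simp)] at this

/-! ### The tree rooted at a vertex, and its subdivision -/

namespace SimpleGraph

open RotationSystem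

variable {V : Type*} {H : SimpleGraph V} {R : H.RotationSystem} {f : R.Face}

/-- A dart of the tree that leads away from `r`. -/
def IsDown (R : H.RotationSystem) (f : R.Face) (r : V) (d : H.Dart) : Prop :=
  (R.skeleton f).Adj d.fst d.snd ∧
    (R.skeleton f).dist r d.snd = (R.skeleton f).dist r d.fst + 1

/-- Two successive darts that lead away from `r`. -/
def IsChild (R : H.RotationSystem) (f : R.Face) (r : V) (d d' : H.Dart) : Prop :=
  IsDown R f r d ∧ IsDown R f r d' ∧ d'.fst = d.snd

/-- The dart `d'` can be reached from `d` on a path that leads away from `r`. -/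
abbrev IsDescendant (R : H.RotationSystem) (f : R.Face) (r : V) : H.Dart → H.Dart → Prop :=
  Relation.ReflTransGen (IsChild R f r)

section Down

variable {r : V} {d d' e : H.Dart}

lemma isDown_or_symm (hT : (R.skeleton f).IsTree) (r : V)
    (hd : (R.skeleton f).Adj d.fst d.snd) : IsDown R f r d ∨ IsDown R f r d.symm := by
  rcases hT.dist_eq_dist_add_one_of_adj r hd with h | h
  · exact Or.inr ⟨hd.symm, h⟩
  · exact Or.inl ⟨hd, h⟩

/-- Shortest walks from `r` to the two parents, prolonged to the common child, are both paths, hence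
equal in a tree; so are their penultimate vertices. -/
lemma IsDown.eq_of_snd_eq (hT : (R.skeleton f).IsTree) (hd : IsDown R f r d)
    (hd' : IsDown R f r d') (h : d.snd = d'.snd) : d = d' := by
  obtain ⟨p, hp⟩ := hT.connected.exists_walk_length_eq_dist r d.fst
  obtain ⟨q, hq⟩ := hT.connected.exists_walk_length_eq_dist r d'.fst
  have h1 : (p.concat hd.1).IsPath :=
    Walk.isPath_of_length_eq_dist _ (by rw [Walk.length_concat, hp, hd.2])
  have hadj : (R.skeleton f).Adj d'.fst d.snd := h ▸ hd'.1
  have h4 : (q.concat hadj).IsPath :=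
    Walk.isPath_of_length_eq_dist _ (by rw [Walk.length_concat, hq, h, hd'.2])
  have h5 : p.concat hd.1 = q.concat hadj :=
    congrArg Subtype.val ((hT.isAcyclic.subsingleton_path _ _).elim ⟨_, h1⟩ ⟨_, h4⟩)
  have h6 := congrArg Walk.penultimate h5
  rw [Walk.penultimate_concat, Walk.penultimate_concat] at h6
  exact Dart.ext _ _ (Prod.ext h6 h)

lemma not_isDown_symm (hd : IsDown R f r d) : ¬ IsDown R f r d.symm := by
  intro h
  have h1 := hd.2
  have h2 : (R.skeleton f).dist r d.fst = (R.skeleton f).dist r d.snd + 1 := h.2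
  omega

lemma IsDown.isChild (hT : (R.skeleton f).IsTree) (hd : IsDown R f r d)
    (he : (R.skeleton f).Adj e.fst e.snd) (h : e.fst = d.snd) (hne : e ≠ d.symm) :
    IsChild R f r d e := by
  refine ⟨hd, (isDown_or_symm hT r he).resolve_right fun h' => hne ?_, h⟩
  have : d = e.symm := hd.eq_of_snd_eq hT h' h.symm
  rw [this, Dart.symm_symm]

lemma exists_isDown (hT : (R.skeleton f).IsTree) {v : V} (hv : v ≠ r) :
    ∃ d : H.Dart, IsDown R f r d ∧ d.snd = v := by
  obtain ⟨p, hp⟩ := hT.connected.exists_walk_length_eq_dist r v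
  have hnil : ¬ p.Nil := fun h => hv h.eq.symm
  have hadj := p.adj_penultimate hnil
  let d : H.Dart := ⟨(p.penultimate, v), (deleteEdges_adj.1 hadj).1⟩
  rcases isDown_or_symm (d := d) hT r hadj with h | h
  · exact ⟨d, h, rfl⟩
  · exfalso
    have h1 : (R.skeleton f).dist r p.penultimate = (R.skeleton f).dist r v + 1 := h.2
    have h2 := dist_le p.dropLast
    have h3 : p.dropLast.length + 1 = p.length := by
      rw [← Walk.length_concat p.dropLast hadj, Walk.concat_dropLast]
    omega

lemma IsDescendant.isDown (h : IsDescendant R f r d e) (hd : IsDown R f r d) :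
    IsDown R f r e := by
  rcases Relation.ReflTransGen.cases_tail h with rfl | ⟨x, -, hx⟩
  · exact hd
  · exact hx.2.1

lemma IsDescendant.eq_or_dist_lt (h : IsDescendant R f r d e) :
    e = d ∨ (R.skeleton f).dist r d.snd < (R.skeleton f).dist r e.snd := by
  induction h with
  | refl => exact Or.inl rfl
  | tail _ hx ih =>
    right
    have h1 := hx.2.1.2
    rw [hx.2.2] at h1
    rcases ih with rfl | h
    · omega
    · omega

/-- Parents are unique, so the ancestors of `x` form a chain, along which the depth strictly
increases. -/
lemma IsDescendant.eq_of_dist_eq (hT : (R.skeleton f).IsTree) {x : H.Dart}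
    (h : IsDescendant R f r d x) (h' : IsDescendant R f r d' x)
    (hdist : (R.skeleton f).dist r d.snd = (R.skeleton f).dist r d'.snd) : d = d' := by
  have hu : Relator.RightUnique (Function.swap (IsChild R f r)) := by
    intro a b c hb hc
    exact hb.1.eq_of_snd_eq hT hc.1 (hb.2.2.symm.trans hc.2.2)
  rcases Relation.ReflTransGen.total_of_right_unique hu h.swap h'.swap with h1 | h1
  · rcases IsDescendant.eq_or_dist_lt (R := R) (f := f) (r := r) h1.swap with h | h
    · exact h
    · omega
  · rcases IsDescendant.eq_or_dist_lt (R := R) (f := f) (r := r) h1.swap with h | h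
    · exact h.symm
    · omega

lemma IsDescendant.eq_or_exists_isChild (h : IsDescendant R f r d e) :
    e = d ∨ ∃ x, IsChild R f r d x ∧ IsDescendant R f r x e := by
  rcases Relation.ReflTransGen.cases_head h with h | ⟨x, h1, h2⟩
  · exact Or.inl h.symm
  · exact Or.inr ⟨x, h1, h2⟩

end Down

variable {W : Type*} {G : SimpleGraph W}

namespace Subdivision

variable (S : Subdivision H G)

/-- The vertices on the path that represents `d`, apart from the first one. -/
def Owns (d : H.Dart) (w : W) : Prop := w ∈ (S.path d).support.tail

lemma vertex_fst_ne (d : H.Dart) : S.vertex d.fst ≠ S.vertex d.snd := fun h =>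
  d.fst_ne_snd (S.vertex.injective h)

lemma owns_snd (d : H.Dart) : S.Owns d (S.vertex d.snd) := by
  have h := (S.path d).end_mem_support
  rw [Walk.mem_support_iff] at h
  exact h.resolve_left (S.vertex_fst_ne d).symm

lemma Owns.mem_support {S : Subdivision H G} {d : H.Dart} {w : W} (h : S.Owns d w) :
    w ∈ (S.path d).support := List.mem_of_mem_tail h

lemma Owns.ne_fst {S : Subdivision H G} {d : H.Dart} {w : W} (h : S.Owns d w) :
    w ≠ S.vertex d.fst := by
  rintro rfl
  have := (S.isPath d).support_nodup
  rw [← Walk.cons_tail_support] at this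
  exact (List.nodup_cons.1 this).1 h

lemma Owns.snd_eq {S : Subdivision H G} {d : H.Dart} {v : V} (h : S.Owns d (S.vertex v)) :
    v = d.snd :=
  (S.eq_end_of_vertex_mem d v h.mem_support).resolve_left fun h' => h.ne_fst (by rw [h'])

/-- Since `Owns` leaves out the first vertex of a path, the image of a vertex of `H` belongs only to
the downward dart that enters it; any other vertex is interior to the path of a single edge. -/
lemma Owns.unique {S : Subdivision H G} (hT : (R.skeleton f).IsTree) {r : V} {d d' : H.Dart}
    {w : W} (h : S.Owns d w) (h' : S.Owns d' w) (hd : IsDown R f r d) (hd' : IsDown R f r d') :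
    d = d' := by
  rcases S.interior_disjoint d d' w h.mem_support h'.mem_support with he | ⟨v, rfl⟩
  · rcases (dart_edge_eq_iff _ _).1 he with h | h
    · exact h
    · subst h
      exact absurd hd (not_isDown_symm hd')
  · exact hd.eq_of_snd_eq hT hd' (h.snd_eq.symm.trans h'.snd_eq)

lemma edges_symm (d : H.Dart) {e : Sym2 W} :
    e ∈ (S.path d.symm).edges ↔ e ∈ (S.path d).edges := by
  have h : (S.path d.symm).edges = (S.path d).edges.reverse :=
    (congrArg Walk.edges (S.path_symm d)).trans (Walk.edges_reverse _)
  rw [h, List.mem_reverse]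

lemma support_symm (d : H.Dart) {w : W} :
    w ∈ (S.path d.symm).support ↔ w ∈ (S.path d).support := by
  have h : (S.path d.symm).support = (S.path d).support.reverse :=
    (congrArg Walk.support (S.path_symm d)).trans (Walk.support_reverse _)
  rw [h, List.mem_reverse]

/-- An edge that is not subdivided. -/
lemma eq_of_length_eq_one {d : H.Dart} (h : (S.path d).length = 1) :
    (∀ w ∈ (S.path d).support, w = S.vertex d.fst ∨ w = S.vertex d.snd) ∧
    ∀ e ∈ (S.path d).edges, e = s(S.vertex d.fst, S.vertex d.snd) := by
  have key : ∀ {u v : W} (p : G.Walk u v), p.length = 1 →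
      (∀ w ∈ p.support, w = u ∨ w = v) ∧ ∀ e ∈ p.edges, e = s(u, v) := by
    intro u v p hp
    cases p with
    | nil => simp at hp
    | cons h' p =>
      cases p with
      | nil => simp
      | cons h'' p => simp at hp
  exact key _ h

/-- The outer edges are not subdivided, so their paths contribute no further vertices. -/
lemma owned_or_eq (hT : (R.skeleton f).IsTree)
    (hS : ∀ d : H.Dart, d.edge ∈ R.faceEdges f → (S.path d).length = 1) (r : V) (w : W) :
    w = S.vertex r ∨ ∃ d, IsDown R f r d ∧ S.Owns d w := by
  have hvert : ∀ v, S.vertex v = S.vertex r ∨ ∃ d, IsDown R f r d ∧ S.Owns d (S.vertex v) := by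
    intro v
    by_cases hv : v = r
    · exact Or.inl (by rw [hv])
    · obtain ⟨d, hd, rfl⟩ := exists_isDown (R := R) (f := f) hT hv
      exact Or.inr ⟨d, hd, S.owns_snd d⟩
  rcases S.vertex_covered w with ⟨v, rfl⟩ | ⟨d, hw⟩
  · exact hvert v
  by_cases hd : d.edge ∈ R.faceEdges f
  · rcases (S.eq_of_length_eq_one (hS d hd)).1 w hw with rfl | rfl <;> exact hvert _
  have hadj : (R.skeleton f).Adj d.fst d.snd := deleteEdges_adj.2 ⟨d.adj, hd⟩
  have key : ∀ d : H.Dart, IsDown R f r d → w ∈ (S.path d).support →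
      w = S.vertex r ∨ ∃ d, IsDown R f r d ∧ S.Owns d w := by
    intro d hd hw
    rw [Walk.mem_support_iff] at hw
    rcases hw with rfl | hw
    · exact hvert _
    · exact Or.inr ⟨d, hd, hw⟩
  rcases isDown_or_symm hT r hadj with h | h
  · exact key d h hw
  · exact key d.symm h ((S.support_symm d).2 hw)

end Subdivision

/-! ### Reading an ordered forest off the rotation system -/

/-- The tree with root `a` and subtrees `c` consists of the paths that represent the descendants of
the dart `d`, its leaves being ordered as on the outer face. -/
structure RepresentsBranch (S : Subdivision H G) (R : H.RotationSystem) (f : R.Face) (r : V)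
    (d : H.Dart) (a : W) (c : OrderedForest W) : Prop where
  mem : ∀ w, w ∈ a :: c.labels ↔ ∃ x, IsDescendant R f r d x ∧ S.Owns x w
  nodup : (a :: c.labels).Nodup
  edges : ∀ x, IsDescendant R f r d x → ∀ e ∈ (S.path x).edges,
    e = s(S.vertex d.fst, a) ∨ e ∈ c.edges a none
  first : ∃ i : H.Dart, R.faceOf i.symm = f ∧ R.faceOf i = R.faceOf d ∧
    c.firstLeaf a = S.vertex i.fst
  last : ∃ i : H.Dart, R.faceOf i.symm = f ∧ R.faceOf i = R.faceOf d.symm ∧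
    c.lastLeaf a = S.vertex i.snd
  leafEdges : ∀ x, IsDescendant R f r d x → ∀ i : H.Dart, R.faceOf i.symm = f →
    R.faceOf i = R.faceOf x.symm →
    R.faceOf i = R.faceOf d.symm ∨ s(S.vertex i.fst, S.vertex i.snd) ∈ c.edges a none

/-- The forest `c` consists of the branches that represent the successive darts `d` and `l`. -/
structure RepresentsBranches (S : Subdivision H G) (R : H.RotationSystem) (f : R.Face) (r : V)
    (d : H.Dart) (l : List H.Dart) (c : OrderedForest W) : Prop where
  ne_nil : c ≠ .nil
  mem : ∀ w, w ∈ c.labels ↔ ∃ y ∈ d :: l, ∃ x, IsDescendant R f r y x ∧ S.Owns x w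
  nodup : c.labels.Nodup
  edges : ∀ y ∈ d :: l, ∀ x, IsDescendant R f r y x → ∀ e ∈ (S.path x).edges,
    e ∈ c.edges (S.vertex d.fst) none
  first : ∃ i : H.Dart, R.faceOf i.symm = f ∧ R.faceOf i = R.faceOf d ∧
    ∀ w, c.firstLeaf w = S.vertex i.fst
  last : ∃ i : H.Dart, R.faceOf i.symm = f ∧
    R.faceOf i = R.faceOf ((d :: l).getLast (by simp)).symm ∧ ∀ w, c.lastLeaf w = S.vertex i.snd
  leafEdges : ∀ y ∈ d :: l, ∀ x, IsDescendant R f r y x → ∀ i : H.Dart, R.faceOf i.symm = f →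
    R.faceOf i = R.faceOf x.symm →
    R.faceOf i = R.faceOf ((d :: l).getLast (by simp)).symm ∨
      s(S.vertex i.fst, S.vertex i.snd) ∈ c.edges (S.vertex d.fst) none

namespace IsEmbeddedHalin

variable (hH : H.IsEmbeddedHalin R f) (S : Subdivision H G) {r : V}

include hH

open OrderedForest

/-- Successive branches, at `d` and at `R.next d`, share the face of `d.symm`. The unique outer edge
of this face joins the last leaf of the former to the first leaf of the latter, and it is the edge
that `cons` adds between the two. -/
lemma exists_representsBranches (l : List H.Dart) : ∀ d : H.Dart,
    (d :: l).IsChain (fun y z => z = R.next y) → (d :: l).Nodup →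
    (∀ y ∈ d :: l, IsDown R f r y ∧ ∃ a c, RepresentsBranch S R f r y a c) →
    ∃ c, RepresentsBranches S R f r d l c := by
  induction l with
  | nil =>
    intro d _ _ hy
    obtain ⟨a, c, h⟩ := (hy d (by simp)).2
    have hed : (cons a c nil).edges (S.vertex d.fst) none =
        insert s(S.vertex d.fst, a) (c.edges a none) := by
      simp [OrderedForest.edges, optionEdge]
    refine ⟨cons a c nil, by simp, ?_, ?_, ?_, ?_, ?_, ?_⟩
    · intro w
      rw [labels_cons_nil, h.mem]
      simp
    · rw [labels_cons_nil]
      exact h.nodup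
    · intro y hy x hx e he
      rw [List.mem_singleton] at hy
      subst hy
      rw [hed]
      exact h.edges x hx e he
    · obtain ⟨i, h1, h2, h3⟩ := h.first
      exact ⟨i, h1, h2, fun _ => h3⟩
    · obtain ⟨i, h1, h2, h3⟩ := h.last
      exact ⟨i, h1, h2, fun _ => h3⟩
    · intro y hy x hx i h1 h2
      rw [List.mem_singleton] at hy
      subst hy
      rw [hed]
      exact (h.leafEdges x hx i h1 h2).imp_right Or.inr
  | cons d' l ih =>
    intro d hchain hnd hy
    obtain ⟨hd', hchain'⟩ := List.isChain_cons_cons.1 hchain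
    obtain ⟨hdn, hnd'⟩ := List.nodup_cons.1 hnd
    obtain ⟨C, hC⟩ := ih d' hchain' hnd' fun y hy' => hy y (List.mem_cons_of_mem _ hy')
    obtain ⟨a, c, h⟩ := (hy d (by simp)).2
    have hfst : d'.fst = d.fst := by rw [hd', R.fst_next]
    have hall : ∀ y ∈ d' :: l, y.fst = d.fst := by
      have : ∀ (l : List H.Dart) (d' : H.Dart), (d' :: l).IsChain (fun y z => z = R.next y) →
          ∀ y ∈ d' :: l, y.fst = d'.fst := by
        intro l
        induction l with
        | nil => simp
        | cons x l ih =>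
          intro d' hc y hy
          obtain ⟨h1, h2⟩ := List.isChain_cons_cons.1 hc
          rcases List.mem_cons.1 hy with rfl | hy
          · rfl
          · rw [ih x h2 y hy, h1, R.fst_next]
      exact fun y hy => (this l d' hchain' y hy).trans hfst
    have hed : (cons a c C).edges (S.vertex d.fst) none =
        insert s(S.vertex d.fst, a) (c.edges a none ∪
          C.edges (S.vertex d.fst) (some (c.lastLeaf a))) := by
      simp [OrderedForest.edges, optionEdge]
    have hCed : ∀ e ∈ C.edges (S.vertex d'.fst) none,
        e ∈ (cons a c C).edges (S.vertex d.fst) none := by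
      intro e he
      rw [hfst] at he
      rw [hed]
      exact Or.inr (Or.inr (edges_none_subset _ _ _ he))
    have hglast : (d :: d' :: l).getLast (by simp) = (d' :: l).getLast (by simp) :=
      List.getLast_cons (by simp)
    refine ⟨cons a c C, by simp, ?_, ?_, ?_, ?_, ?_, ?_⟩
    · intro w
      rw [Sketch.mem_labels_cons, h.mem, hC.mem]
      simp only [List.exists_mem_cons_iff]
    · have hperm : (cons a c C).labels = (a :: c.labels) ++ C.labels := rfl
      rw [hperm, List.nodup_append]
      refine ⟨h.nodup, hC.nodup, ?_⟩
      rintro w hw _ hw' rfl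
      obtain ⟨x, hx, hxw⟩ := (h.mem w).1 hw
      obtain ⟨y, hyl, x', hx', hxw'⟩ := (hC.mem w).1 hw'
      have hdown := (hy d (by simp)).1
      have hdowny := (hy y (List.mem_cons_of_mem _ hyl)).1
      have hxx : x = x' := hxw.unique hH.isTree hxw' (IsDescendant.isDown hx hdown)
        (IsDescendant.isDown hx' hdowny)
      subst hxx
      -- Both branches start at the same depth, so a common descendant identifies them.
      have : d = y := IsDescendant.eq_of_dist_eq hH.isTree hx hx' (by
        rw [hdown.2, hdowny.2, hall y hyl])
      exact hdn (this ▸ hyl)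
    · intro y hyl x hx e he
      rcases List.mem_cons.1 hyl with rfl | hyl
      · rw [hed]
        rcases h.edges x hx e he with h | h
        · exact Or.inl h
        · exact Or.inr (Or.inl h)
      · exact hCed e (hC.edges y hyl x hx e he)
    · obtain ⟨i, h1, h2, h3⟩ := h.first
      exact ⟨i, h1, h2, fun _ => h3⟩
    · obtain ⟨i, h1, h2, h3⟩ := hC.last
      exact ⟨i, h1, by rw [hglast, h2], fun w => h3 _⟩
    · intro y hyl x hx i h1 h2
      rw [hglast]
      rcases List.mem_cons.1 hyl with rfl | hyl
      · rcases h.leafEdges x hx i h1 h2 with h' | h'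
        · right
          obtain ⟨j, hj1, hj2, hj3⟩ := h.last
          obtain ⟨k, hk1, hk2, hk3⟩ := hC.first
          have e1 : i = j := hH.inner_unique h1 hj1 (h'.trans hj2.symm)
          have e2 : i = k := hH.inner_unique h1 hk1 (by rw [hk2, h', hd', R.faceOf_next])
          have := edge_firstLeaf_mem hC.ne_nil (S.vertex y.fst) (c.lastLeaf a) a
          rw [hj3, hk3, ← e1, ← e2, Sym2.eq_swap] at this
          rw [hed, hj3, ← e1]
          exact Or.inr (Or.inr this)
        · right
          rw [hed]
          exact Or.inr (Or.inl h')
      · exact (hC.leafEdges y hyl x hx i h1 h2).imp_right (hCed _)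

end IsEmbeddedHalin

end SimpleGraph


namespace SimpleGraph

open RotationSystem OrderedForest

variable {V : Type*} {H : SimpleGraph V} {R : H.RotationSystem} {f : R.Face}
  {W : Type*} {G : SimpleGraph W}

/-- The forest `c` consists of the paths that represent the proper descendants of the dart `d`. -/
structure RepresentsBelow (S : Subdivision H G) (R : H.RotationSystem) (f : R.Face) (r : V)
    (d : H.Dart) (c : OrderedForest W) : Prop where
  mem : ∀ w, w ∈ c.labels ↔ ∃ x, x ≠ d ∧ IsDescendant R f r d x ∧ S.Owns x w
  nodup : c.labels.Nodup
  edges : ∀ x, x ≠ d → IsDescendant R f r d x → ∀ e ∈ (S.path x).edges,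
    e ∈ c.edges (S.vertex d.snd) none
  first : ∃ i : H.Dart, R.faceOf i.symm = f ∧ R.faceOf i = R.faceOf d ∧
    c.firstLeaf (S.vertex d.snd) = S.vertex i.fst
  last : ∃ i : H.Dart, R.faceOf i.symm = f ∧ R.faceOf i = R.faceOf d.symm ∧
    c.lastLeaf (S.vertex d.snd) = S.vertex i.snd
  leafEdges : ∀ x, x ≠ d → IsDescendant R f r d x → ∀ i : H.Dart, R.faceOf i.symm = f →
    R.faceOf i = R.faceOf x.symm →
    R.faceOf i = R.faceOf d.symm ∨
      s(S.vertex i.fst, S.vertex i.snd) ∈ c.edges (S.vertex d.snd) none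

lemma IsChild.ne_of_isDescendant {r : V} {d y x : H.Dart} (h : IsChild R f r d y)
    (hx : IsDescendant R f r y x) : x ≠ d := by
  rintro rfl
  have h1 := h.2.1.2
  rw [h.2.2] at h1
  rcases hx.eq_or_dist_lt with rfl | h2 <;> omega

namespace IsEmbeddedHalin

variable (hH : H.IsEmbeddedHalin R f) (S : Subdivision H G) {r : V}

include hH

lemma exists_representsBranch_of_below {d : H.Dart} (hd : IsDown R f r d) {C : OrderedForest W}
    (hC : RepresentsBelow S R f r d C) : ∃ a c, RepresentsBranch S R f r d a c := by
  obtain ⟨a, c, h1, h2, h3, h4, h5⟩ := exists_tree_of_walk (S.path d) (S.vertex_fst_ne d) C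
  refine ⟨a, c, ?_, ?_, ?_, ?_, ?_, ?_⟩
  · intro w
    rw [h1, List.mem_append, hC.mem]
    constructor
    · rintro (h | ⟨x, -, hx⟩)
      · exact ⟨d, .refl, h⟩
      · exact ⟨x, hx⟩
    · rintro ⟨x, hx, hw⟩
      by_cases hxd : x = d
      · exact Or.inl (hxd ▸ hw)
      · exact Or.inr ⟨x, hxd, hx, hw⟩
  · rw [h1, List.nodup_append]
    refine ⟨(S.isPath d).support_nodup.tail, hC.nodup, ?_⟩
    rintro w hw _ hw' rfl
    obtain ⟨x, hxd, hx, hxw⟩ := (hC.mem w).1 hw'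
    exact hxd (hxw.unique hH.isTree hw (IsDescendant.isDown hx hd) hd)
  · intro x hx e he
    by_cases hxd : x = d
    · subst hxd
      exact h2 e he
    · exact Or.inr (h3 (hC.edges x hxd hx e he))
  · rw [h4]
    exact hC.first
  · rw [h5]
    exact hC.last
  · intro x hx i hi1 hi2
    by_cases hxd : x = d
    · subst hxd
      exact Or.inl hi2
    · exact (hC.leafEdges x hxd hx i hi1 hi2).imp_right fun h => h3 h

/-- An outer vertex has no tree edge besides the one that leads to it. Its two neighbours in the
rotation give the outer edges of the faces on both sides of `d`. -/
lemma representsBelow_leaf {d : H.Dart} (hd : IsDown R f r d) (hz : d.snd ∈ R.faceVertices f) :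
    RepresentsBelow S R f r d nil := by
  obtain ⟨o, ho, hov⟩ := hz
  have hdesc : ∀ x, x ≠ d → ¬ IsDescendant R f r d x := by
    intro x hxd hx
    rcases hx.eq_or_exists_isChild with h | ⟨y, hy, -⟩
    · exact hxd h
    · have : y = d.symm := hH.tree_dart_unique ho (hy.2.2.trans hov.symm) hov.symm hy.2.1.1
        hd.1.symm
      exact not_isDown_symm hd (this ▸ hy.2.1)
  refine ⟨fun w => ?_, by simp [labels], fun x h1 h2 => absurd h2 (hdesc x h1), ?_, ?_,
    fun x h1 h2 => absurd h2 (hdesc x h1)⟩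
  · simp only [labels, List.not_mem_nil, false_iff]
    rintro ⟨x, h1, h2, -⟩
    exact hdesc x h1 h2
  · refine ⟨R.next d.symm, hH.faceOf_next_symm ho hov.symm hd.1.symm, ?_, ?_⟩
    · rw [R.faceOf_next, Dart.symm_symm]
    · rw [R.fst_next]
      rfl
  · have : R.next o = d.symm := hH.tree_dart_unique ho (R.fst_next o) hov.symm
      (hH.skeleton_adj_next ho) hd.1.symm
    refine ⟨o.symm, by rwa [Dart.symm_symm], by rw [← this, R.faceOf_next], ?_⟩
    change S.vertex d.snd = S.vertex o.fst
    rw [hov]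

/-- At a vertex off the outer face, the rotation read from `d.symm` onward lists exactly the
children. The first child shares the face of `d` and the last one shares the face of `d.symm`, so
the end leaves are those required. -/
lemma exists_representsBelow {d : H.Dart} (hd : IsDown R f r d)
    (ih : ∀ y, IsChild R f r d y → ∃ a c, RepresentsBranch S R f r y a c) :
    ∃ C, RepresentsBelow S R f r d C := by
  by_cases hz : d.snd ∈ R.faceVertices f
  · exact ⟨nil, hH.representsBelow_leaf S hd hz⟩
  have := hH.finite
  have : Finite H.Dart := Finite.of_injective _ Dart.toProd_injective
  -- A fixed dart would be alone at its vertex, which would be a leaf and hence on the outer face.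
  have hne : R.next d.symm ≠ d.symm := by
    intro hfix
    apply hz
    apply hH.leaf_mem_outer
    rw [Set.ncard_eq_one]
    refine ⟨d.fst, ?_⟩
    ext u
    constructor
    · intro hu
      have hu : (R.skeleton f).Adj d.snd u := hu
      let e : H.Dart := ⟨(d.snd, u), (deleteEdges_adj.1 hu).1⟩
      have := (R.sameCycle_of_fst_eq d.symm e rfl).apply_eq_of_invariant
        (χ := fun x => x = d.symm) (fun a => by
          rw [eq_iff_iff]
          constructor
          · intro h
            exact R.next.injective (h.trans hfix.symm)
          · rintro rfl
            exact hfix)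
      have he : e = d.symm := this ▸ rfl
      exact congrArg (fun d : H.Dart => d.snd) he
    · rintro rfl
      exact hd.1.symm
  obtain ⟨d₁, l, hd₁, hchain, hnd, hmem, hlast⟩ := R.next.exists_chain_of_ne hne
  have hd₁fst : d₁.fst = d.snd := by rw [hd₁, R.fst_next]; rfl
  have hchild : ∀ y, y ∈ d₁ :: l ↔ IsChild R f r d y := by
    intro y
    rw [hmem]
    constructor
    · rintro ⟨h1, h2⟩
      have hy : y.fst = d.snd :=
        (h1.apply_eq_of_invariant (χ := fun x : H.Dart => x.fst) R.fst_next).symm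
      exact hd.isChild hH.isTree (skeleton_adj_of_not_mem_outer (hy ▸ hz)) hy h2
    · intro h
      refine ⟨R.sameCycle_of_fst_eq _ _ h.2.2.symm, fun h' => ?_⟩
      exact not_isDown_symm hd (h' ▸ h.2.1)
  have hdesc : ∀ x, (x ≠ d ∧ IsDescendant R f r d x) ↔
      ∃ y ∈ d₁ :: l, IsDescendant R f r y x := by
    intro x
    constructor
    · rintro ⟨h1, h2⟩
      obtain ⟨y, hy, hyx⟩ := h2.eq_or_exists_isChild.resolve_left h1
      exact ⟨y, (hchild y).2 hy, hyx⟩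
    · rintro ⟨y, hy, hyx⟩
      have hy := (hchild y).1 hy
      exact ⟨hy.ne_of_isDescendant hyx, hyx.head hy⟩
  obtain ⟨C, hC⟩ := hH.exists_representsBranches S l d₁ hchain hnd fun y hy =>
    ⟨((hchild y).1 hy).2.1, ih y ((hchild y).1 hy)⟩
  have hfaceLast : R.faceOf ((d₁ :: l).getLast (by simp)).symm = R.faceOf d.symm := by
    rw [← R.faceOf_next, hlast]
  refine ⟨C, ?_, hC.nodup, ?_, ?_, ?_, ?_⟩
  · intro w
    rw [hC.mem]
    constructor
    · rintro ⟨y, hy, x, hx, hw⟩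
      obtain ⟨h1, h2⟩ := (hdesc x).2 ⟨y, hy, hx⟩
      exact ⟨x, h1, h2, hw⟩
    · rintro ⟨x, h1, h2, hw⟩
      obtain ⟨y, hy, hx⟩ := (hdesc x).1 ⟨h1, h2⟩
      exact ⟨y, hy, x, hx, hw⟩
  · intro x h1 h2 e he
    obtain ⟨y, hy, hx⟩ := (hdesc x).1 ⟨h1, h2⟩
    rw [← hd₁fst]
    exact hC.edges y hy x hx e he
  · obtain ⟨i, h1, h2, h3⟩ := hC.first
    refine ⟨i, h1, ?_, h3 _⟩
    rw [h2, hd₁, R.faceOf_next, Dart.symm_symm]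
  · obtain ⟨i, h1, h2, h3⟩ := hC.last
    exact ⟨i, h1, h2.trans hfaceLast, h3 _⟩
  · intro x h1 h2 i hi1 hi2
    obtain ⟨y, hy, hx⟩ := (hdesc x).1 ⟨h1, h2⟩
    rw [← hd₁fst, ← hfaceLast]
    exact hC.leafEdges y hy x hx i hi1 hi2

lemma exists_representsBranch (d : H.Dart) (hd : IsDown R f r d) :
    ∃ a c, RepresentsBranch S R f r d a c := by
  have := hH.finite
  obtain ⟨N, hN⟩ := (Set.finite_range fun v => (R.skeleton f).dist r v).bddAbove
  have hN : ∀ v, (R.skeleton f).dist r v ≤ N := fun v => hN ⟨v, rfl⟩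
  -- Induction from the deepest darts upward: `N` bounds all depths, and a child is one deeper than
  -- its parent.
  induction hn : N - (R.skeleton f).dist r d.snd using Nat.strong_induction_on generalizing d with
  | _ n ih =>
    obtain ⟨C, hC⟩ := hH.exists_representsBelow S hd fun y hy => by
      refine ih _ ?_ y hy.2.1 rfl
      have h1 := hy.2.1.2
      rw [hy.2.2] at h1
      have h2 := hN y.snd
      omega
    exact hH.exists_representsBranch_of_below S hd hC

/-- In a generalized Halin graph, drawn as a tree that hangs from a leaf `r`, all edges are edges
of the tree, edges between consecutive leaves, or edges between `r` and the first or last leaf. -/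
theorem exists_orderedForest
    (hS : ∀ d : H.Dart, d.edge ∈ R.faceEdges f → (S.path d).length = 1) :
    ∃ (w a : W) (c : OrderedForest W), (w :: a :: c.labels).Nodup ∧
      (∀ z, z ∈ w :: a :: c.labels) ∧ ∀ e ∈ G.edgeSet,
        e = s(w, a) ∨ e = s(w, c.firstLeaf a) ∨ e = s(w, c.lastLeaf a) ∨ e ∈ c.edges a none := by
  obtain ⟨o, ho⟩ := Quotient.exists_rep f
  have ho : R.faceOf o = f := ho
  set r := o.fst with hr
  set t := R.next o with ht
  have htr : t.fst = r := R.fst_next o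
  have htadj : (R.skeleton f).Adj t.fst t.snd := hH.skeleton_adj_next ho
  have htd : IsDown R f r t := by
    refine (isDown_or_symm hH.isTree r htadj).resolve_right fun h => ?_
    have h1 : (R.skeleton f).dist r t.fst = (R.skeleton f).dist r t.snd + 1 := h.2
    rw [htr, dist_self] at h1
    omega
  have hdesc : ∀ x, IsDown R f r x → IsDescendant R f r t x := by
    intro x hx
    induction hn : (R.skeleton f).dist r x.fst generalizing x with
    | zero =>
      have : r = x.fst := (hH.isTree.connected.dist_eq_zero_iff).1 hn
      have : x = t := hH.tree_dart_unique ho this.symm htr hx.1 htadj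
      rw [this]
    | succ n ih =>
      have hxr : x.fst ≠ r := by
        intro h
        rw [h, dist_self] at hn
        omega
      obtain ⟨y, hy, hyx⟩ := exists_isDown (R := R) (f := f) hH.isTree hxr
      have h2 := hy.2
      rw [hyx, hn] at h2
      exact (ih y hy (by omega)).tail ⟨hy, hx, hyx.symm⟩
  obtain ⟨a, c, hc⟩ := hH.exists_representsBranch S t htd
  refine ⟨S.vertex r, a, c, List.nodup_cons.2 ⟨fun h => ?_, hc.nodup⟩, fun z => ?_, fun e he => ?_⟩
  · obtain ⟨x, hx, hw⟩ := (hc.mem _).1 h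
    have h1 := (IsDescendant.isDown hx htd).2
    rw [← hw.snd_eq, dist_self] at h1
    omega
  · rw [List.mem_cons, hc.mem]
    rcases S.owned_or_eq hH.isTree hS r z with h | ⟨d, hd, hdz⟩
    · exact Or.inl h
    · exact Or.inr ⟨d, hdesc d hd, hdz⟩
  · have tree : ∀ x, IsDown R f r x → e ∈ (S.path x).edges →
        e = s(S.vertex r, a) ∨ e ∈ c.edges a none := by
      intro x hx hex
      have := hc.edges x (hdesc x hx) e hex
      rwa [htr] at this
    have outer : ∀ i : H.Dart, R.faceOf i.symm = f → e = s(S.vertex i.fst, S.vertex i.snd) →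
        e = s(S.vertex r, c.firstLeaf a) ∨ e = s(S.vertex r, c.lastLeaf a) ∨
          e ∈ c.edges a none := by
      rintro i hi rfl
      have hadj := hH.skeleton_adj_next hi
      by_cases hir : i.snd = r
      · left
        have h1 : R.next i.symm = t :=
          hH.tree_dart_unique ho ((R.fst_next _).trans hir) htr hadj htadj
        obtain ⟨j, hj1, hj2, hj3⟩ := hc.first
        -- `i` is the only dart of the face of `t` whose reversal is outer, so it starts at the
        -- first leaf.
        have : i = j := hH.inner_unique hi hj1 (by
          rw [hj2, ← h1, R.faceOf_next, Dart.symm_symm])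
        rw [hj3, ← this, hir, Sym2.eq_swap]
      · right
        obtain ⟨x, hx, hxi⟩ := exists_isDown (R := R) (f := f) hH.isTree hir
        have h1 : R.next i.symm = x.symm :=
          hH.tree_dart_unique hi (R.fst_next _) hxi hadj hx.1.symm
        have hface : R.faceOf i = R.faceOf x.symm := by
          rw [← h1, R.faceOf_next, Dart.symm_symm]
        rcases hc.leafEdges x (hdesc x hx) i hi hface with h2 | h2
        · left
          obtain ⟨j, hj1, hj2, hj3⟩ := hc.last
          have e1 : i = j := hH.inner_unique hi hj1 (h2.trans hj2.symm)
          -- In the face of `t.symm` the only dart with outer reversal is `R.next t`; it leads from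
          -- `r` to the last leaf.
          have e2 : i = R.next t := hH.inner_unique hi (hH.faceOf_next_symm ho htr htadj)
            (by rw [h2, R.faceOf_next])
          have e3 : i.fst = r := by rw [e2, R.fst_next, htr]
          rw [hj3, ← e1, e3]
        · exact Or.inr h2
    obtain ⟨d, hd⟩ := S.edge_covered e he
    by_cases hdf : d.edge ∈ R.faceEdges f
    · right
      have hed := (S.eq_of_length_eq_one (hS d hdf)).2 e hd
      rcases mem_faceEdges.1 hdf with h | h
      · exact outer d.symm (by rwa [Dart.symm_symm]) (hed.trans Sym2.eq_swap)
      · exact outer d h hed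
    · have hadj : (R.skeleton f).Adj d.fst d.snd := deleteEdges_adj.2 ⟨d.adj, hdf⟩
      have : e = s(S.vertex r, a) ∨ e ∈ c.edges a none := by
        rcases isDown_or_symm hH.isTree r hadj with h | h
        · exact tree d h hd
        · exact tree d.symm h ((S.edges_symm d).2 hd)
      tauto

end IsEmbeddedHalin

end SimpleGraph


theorem mainTheorem8 {W : Type*} (G : SimpleGraph W) (hG : G.IsGeneralizedHalin) :
    G.globalEdgeLengthRatio ≤ 5 := by
  obtain ⟨V, H, R, f, hH, S, hS⟩ := hG
  obtain ⟨r, a, c, hnd, hall, hedges⟩ := hH.exists_orderedForest S hS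
  obtain ⟨K, hK, hroot, hfirst, hlast, hrest⟩ := Sketch.exists_of_tree r a c hnd
  refine K.globalEdgeLengthRatio_le (fun u v huv => ?_) fun z => hK z (hall z)
  rw [← SimpleGraph.mem_edgeSet] at huv hroot hfirst hlast ⊢
  rcases hedges _ huv with h | h | h | h
  · rwa [h]
  · rwa [h]
  · rwa [h]
  · exact hrest h
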